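/- All graphs are finite, simple and nonempty. Let $G$ be a graph with complement $\overline{G}$. If $B$ is a set of blue vertices and the others are white, a vertex $u\in B$ can \emph{PSD force} a white vertex $w$ if $w$ is the only neighbor of $u$ in the component of $G-B$ that contains $w$. Put $B^{[0]}=B$ and let $B^{[i+1]}$ be the union of $B^{[i]}$ and the set of all vertices that can be PSD forced by some vertex when $B^{[i]}$ is the set of blue vertices. Let $\mathrm{pt}_+(G;B)$ be the least $t$ with $B^{[t]}=V(G)$, or $\infty$ if there is none; $B$ is a \emph{PSD forcing set} if $\mathrm{pt}_+(G;B)<\infty$. Let $\mathrm{Z}_+(G)$ be the minimum cardinality of a PSD forcing set of $G$ and $\mathrm{pt}_+(G)=\min\{\mathrm{pt}_+(G;B): |B|=\mathrm{Z}_+(G)\}$. For $k\ge 0$ let $H_{2k+8}$ be the graph with the $2k+8$ vertices $x,y,x',y',z,z',a_0,\dots,a_k,b_0,\dots,b_k$ and with the edges $zx,\ zy,\ z'x',\ z'y',\ zz',\ xy,\ yx',\ x'y',\ y'x,\ yy',\ a_0x,\ a_0y',\ b_0y,\ b_0x'$ and $a_ia_{i+1},\ b_ib_{i+1}$ for $0\le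 i<k$. \textbf{Theorem.} For every graph $G$ of order $n\ge 2$, \[1\le \mathrm{pt}_+(G)+\mathrm{pt}_+(\overline{G})\le \frac n2+2 .\] The lower bound is tight for every $n\ge 2$: $\mathrm{pt}_+(K_n)+\mathrm{pt}_+(\overline{K_n})=1$. The upper bound is tight for every even $n\ge 8$: for every $k\ge 0$ the graph $H_{2k+8}$ has order $n=2k+8$ and $\mathrm{pt}_+(H_{2k+8})+\mathrm{pt}_+(\overline{H_{2k+8}})=\frac n2+2$. -/

import Mathlib

open scoped ENNReal

/-- With `B` the set of blue vertices, `u → w` is a PSD force: `u` is blue and there is a component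
of `G - B`, with vertex set `W`, such that `w ∈ W` is the only neighbor of `u` in `W`. -/
def SimpleGraph.IsPSDForce {V : Type*} (G : SimpleGraph V) (B : Set V) (u w : V) : Prop :=
  u ∈ B ∧ ∃ C : (G.induce Bᶜ).ConnectedComponent,
    w ∈ Subtype.val '' C.supp ∧ ∀ v ∈ Subtype.val '' C.supp, G.Adj u v ↔ v = w

/-- The set of vertices that are blue after time step `t`, starting from the set `B` and performing
all possible PSD forces simultaneously at every step. -/
def SimpleGraph.psdBlue {V : Type*} (G : SimpleGraph V) (B : Set V) : ℕ → Set V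
  | 0 => B
  | t + 1 => G.psdBlue B t ∪ {w | ∃ u, G.IsPSDForce (G.psdBlue B t) u w}

/-- PSD forcing sets of a finite graph. -/
def SimpleGraph.IsPSDForcingSet {V : Type*} (G : SimpleGraph V) (B : Finset V) : Prop :=
  ∃ t : ℕ, G.psdBlue (B : Set V) t = Set.univ

/-- The PSD zero forcing number `Z₊(G)` of a finite graph. -/
noncomputable def SimpleGraph.psdForcingNumber {V : Type*} (G : SimpleGraph V) : ℕ :=
  sInf {m : ℕ | ∃ B : Finset V, B.card = m ∧ G.IsPSDForcingSet B}

/-- The PSD propagation time `pt₊(G; B)` of a set of vertices: the least `t` such that all vertices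
are blue after time step `t`, and `⊤` if there is no such `t`. -/
noncomputable def SimpleGraph.psdPropTimeOf {V : Type*} (G : SimpleGraph V) (B : Finset V) : ℕ∞ :=
  ⨅ (t : ℕ) (_ : G.psdBlue (B : Set V) t = Set.univ), (t : ℕ∞)

/-- The PSD propagation time `pt₊(G)`: the minimum of `pt₊(G; B)` over all sets `B` of `Z₊(G)`
vertices. -/
noncomputable def SimpleGraph.psdPropTime {V : Type*} (G : SimpleGraph V) : ℕ∞ :=
  ⨅ (B : Finset V) (_ : B.card = G.psdForcingNumber), G.psdPropTimeOf B

/-- The vertices of the graph `H_{2k+8}`: six vertices `x, y, x', y', z, z'` and the vertices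
`a₀, …, a_k` and `b₀, …, b_k` of two paths. -/
inductive HVertex (k : ℕ) : Type
  | x | y | x' | y' | z | z'
  | a (i : Fin (k + 1))
  | b (i : Fin (k + 1))
  deriving DecidableEq, Fintype

/-- The edges of `H_{2k+8}`, each listed in one direction. -/
def HVertex.edge {k : ℕ} : HVertex k → HVertex k → Prop
  | a i, x => i = 0
  | a i, y' => i = 0
  | b i, y => i = 0
  | b i, x' => i = 0
  | z, x => True
  | z, y => True
  | z', x' => True
  | z', y' => True
  | z, z' => True
  | x, y => True
  | y, x' => True
  | x', y' => True
  | y', x => True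
  | y, y' => True
  | a i, a j => j.val = i.val + 1
  | b i, b j => j.val = i.val + 1
  | _, _ => False

/-- The graph `H_{2k+8}`. -/
def graphH (k : ℕ) : SimpleGraph (HVertex k) :=
  SimpleGraph.fromRel HVertex.edge

/-! The upper bound is the sum of two estimates. The first is pt₊ ≤ ⌈(n − Z₊)/2⌉
(`exists_psdPropTime_le`). Take a fastest minimum forcing set `B` and a component `C` of `G - B`
that finishes last. Every step up to the end colours a vertex of `C`, so |C| ≥ pt₊. If all other
components together were finished at least two steps earlier, exchanging the first forcing vertices
into `C` for the vertices they force would save a step (`exists_faster_of_migration`). Hence the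
remaining components contain at least pt₊ − 1 vertices.

The second is Z₊(G) + Z₊(Gᶜ) ≥ n − 2 (`card_le_psdForcingNumber_add_compl`). The forcing order of
`G` yields a chordal supergraph `H` with cliques of at most Z₊(G) + 1 vertices. If the estimate
failed, every small set would miss a non-edge of `H`, and the forcing process in `Gᶜ` would allow an
infinite descent on connected sets containing such non-edges. Together the estimates give pt₊(G) +
pt₊(Gᶜ) ≤ (2n + 2 − (n − 2))/2.

For `graphH k` this bound leaves only pt₊ ≥ k + 3 and pt₊ ≥ 3 for the complement to be shown. From
three blue vertices one of the two paths is not entered before step 3 (`late_path`, a finite check),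
and its k + 1 vertices are then coloured one per step. In the complement at least five vertices are
white, and five need three steps (`psdBlue_two_ne_univ`), because very few pairs of vertices of
`graphH k` have three common neighbors. -/

namespace SimpleGraph

/-! ### Forces in terms of reachability; locality of the forcing process. -/

variable {V : Type*} {G : SimpleGraph V}

/-- `v` is reached from `w` by a walk of `G` all of whose vertices after `w` lie in `A`. -/
def ReachIn (G : SimpleGraph V) (A : Set V) : V → V → Prop :=
  Relation.ReflTransGen fun a b => G.Adj a b ∧ b ∈ A

theorem ReachIn.mem_of_closed {A S : Set V} {w v : V} (h : G.ReachIn A w v) (hw : w ∈ S)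
    (hS : ∀ a ∈ S, ∀ b, G.Adj a b → b ∈ A → b ∈ S) : v ∈ S := by
  induction h with
  | refl => exact hw
  | tail _ hab ih => exact hS _ ih _ hab.1 hab.2

theorem ReachIn.mem {A : Set V} {w v : V} (h : G.ReachIn A w v) (hw : w ∈ A) : v ∈ A :=
  h.mem_of_closed hw fun _ _ _ _ hb => hb

theorem ReachIn.mono {A A' : Set V} (hA : A ⊆ A') {w v : V} (h : G.ReachIn A w v) :
    G.ReachIn A' w v :=
  Relation.ReflTransGen.lift id (fun _ _ hab => ⟨hab.1, hA hab.2⟩) _ _ h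

theorem ReachIn.symm {A : Set V} {w v : V} (h : G.ReachIn A w v) (hw : w ∈ A) :
    G.ReachIn A v w := by
  induction h with
  | refl => exact .refl
  | tail h hab ih => exact Relation.ReflTransGen.head ⟨hab.1.symm, ReachIn.mem h hw⟩ ih

theorem reachIn_iff {A : Set V} {w v : V} (hw : w ∈ A) (hv : v ∈ A) :
    G.ReachIn A w v ↔ (G.induce A).Reachable ⟨w, hw⟩ ⟨v, hv⟩ := by
  constructor
  · intro h
    induction h with
    | refl => exact Reachable.rfl
    | @tail b c h hab ih =>
      have hb : b ∈ A := ReachIn.mem h hw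
      exact (ih hb).trans (Adj.reachable (by simpa using hab.1))
  · intro h
    rw [reachable_iff_reflTransGen] at h
    have := Relation.ReflTransGen.lift (p := fun a b => G.Adj a b ∧ b ∈ A) Subtype.val
      (fun a b hab => ⟨by simpa using hab, b.2⟩) _ _ h
    exact this

/-- Replaces components of an induced subgraph by walks through white vertices, which are easier to
compare when the blue set changes. -/
theorem isPSDForce_iff {X : Set V} {u w : V} :
    G.IsPSDForce X u w ↔
      u ∈ X ∧ w ∉ X ∧ G.Adj u w ∧ ∀ v, G.ReachIn Xᶜ w v → G.Adj u v → v = w := by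
  constructor
  · rintro ⟨hu, C, ⟨w', hw', rfl⟩, h⟩
    refine ⟨hu, w'.2, (h _ ⟨w', hw', rfl⟩).2 rfl, fun v hv huv => ?_⟩
    have hvX : v ∈ Xᶜ := hv.mem w'.2
    refine (h v ⟨⟨v, hvX⟩, ?_, rfl⟩).1 huv
    rw [ConnectedComponent.mem_supp_iff] at hw' ⊢
    rw [← hw', ConnectedComponent.eq]
    exact ((reachIn_iff w'.2 hvX).1 hv).symm
  · rintro ⟨hu, hw, huw, h⟩
    refine ⟨hu, (G.induce Xᶜ).connectedComponentMk ⟨w, hw⟩,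
      ⟨⟨w, hw⟩, ConnectedComponent.connectedComponentMk_mem, rfl⟩, ?_⟩
    rintro _ ⟨⟨v, hv⟩, hvC, rfl⟩
    rw [ConnectedComponent.mem_supp_iff, ConnectedComponent.eq] at hvC
    exact ⟨fun huv => h v ((reachIn_iff hw hv).2 hvC.symm) huv, by rintro rfl; exact huw⟩

/-- A force in a set `X` of blue vertices stays a force in `X'`, if near the forced vertex,
inside a region `S` with blue boundary, at least as many vertices are blue in `X'` as in `X`. -/
theorem IsPSDForce.transfer {X X' S : Set V} {u w : V} (h : G.IsPSDForce X u w)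
    (hbd : ∀ a ∈ S, ∀ b, G.Adj a b → b ∉ S → b ∈ X') (hsub : ∀ a ∈ S, a ∈ X → a ∈ X')
    (hwS : w ∈ S) (hw : w ∉ X') (hu : u ∈ X') : G.IsPSDForce X' u w := by
  rw [isPSDForce_iff] at h ⊢
  refine ⟨hu, hw, h.2.2.1, fun v hv => h.2.2.2 v ?_⟩
  -- A walk through vertices white in `X'` cannot leave `S`, whose boundary is blue, and inside `S`
  -- it is also white in `X`.
  have : v ∈ S ∧ G.ReachIn Xᶜ w v := by
    induction hv with
    | refl => exact ⟨hwS, .refl⟩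
    | @tail b c _ hbc ih =>
      have hcS : c ∈ S := by
        by_contra hc
        exact hbc.2 (hbd b ih.1 c hbc.1 hc)
      exact ⟨hcS, ih.2.tail ⟨hbc.1, fun hcX => hbc.2 (hsub c hcS hcX)⟩⟩
  exact this.2

theorem psdBlue_mono_time {B : Set V} {s t : ℕ} (h : s ≤ t) : G.psdBlue B s ⊆ G.psdBlue B t := by
  induction h with
  | refl => exact subset_rfl
  | step _ ih => exact ih.trans Set.subset_union_left

theorem subset_psdBlue (B : Set V) (t : ℕ) : B ⊆ G.psdBlue B t :=
  psdBlue_mono_time (s := 0) (Nat.zero_le t)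

theorem mem_psdBlue_succ_of_force {B : Set V} {t : ℕ} {u w : V}
    (h : w ∉ G.psdBlue B t → G.IsPSDForce (G.psdBlue B t) u w) : w ∈ G.psdBlue B (t + 1) := by
  by_cases hw : w ∈ G.psdBlue B t
  · exact Or.inl hw
  · exact Or.inr ⟨u, h hw⟩

theorem psdBlue_mono {B B' : Set V} (h : B ⊆ B') (t : ℕ) : G.psdBlue B t ⊆ G.psdBlue B' t := by
  induction t with
  | zero => exact h
  | succ t ih =>
    rintro w (hw | ⟨u, hu⟩)
    · exact Or.inl (ih hw)
    · exact mem_psdBlue_succ_of_force (u := u) fun hw' => hu.transfer (S := Set.univ) (by simp)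
        (fun a _ ha => ih ha) trivial hw' (ih hu.1)

/-- If the forcing process makes no progress in a union `S` of components of `G - B` in one step,
then it never does afterwards. -/
theorem psdBlue_stall {B S : Set V} (hS : ∀ a ∈ S, ∀ b, G.Adj a b → b ∉ S → b ∈ B) {i : ℕ}
    (hi : ∀ v ∈ S, v ∈ G.psdBlue B (i + 1) → v ∈ G.psdBlue B i) {j : ℕ} (hj : i ≤ j) :
    ∀ v ∈ S, v ∈ G.psdBlue B j → v ∈ G.psdBlue B i := by
  induction hj with
  | refl => exact fun _ _ h => h
  | @step j _ ih =>
    rintro w hwS (hw | ⟨u, hu⟩)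
    · exact ih w hwS hw
    · refine hi w hwS (mem_psdBlue_succ_of_force (u := u) fun hw' => hu.transfer (S := S)
        (fun a ha b hab hb => subset_psdBlue B i (hS a ha b hab hb)) ih hwS hw' ?_)
      by_cases huS : u ∈ S
      · exact ih u huS hu.1
      · exact subset_psdBlue B i (hS w hwS u (isPSDForce_iff.1 hu).2.2.1.symm huS)

/-- By `psdBlue_stall`, each of the first `s` steps colours a new vertex of `S`, and `w` is still
white afterwards. -/
theorem le_ncard_of_late [Finite V] {B S : Set V}
    (hS : ∀ a ∈ S, ∀ b, G.Adj a b → b ∉ S → b ∈ B) {t s : ℕ} (hfin : G.psdBlue B t = Set.univ)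
    {w : V} (hwS : w ∈ S) (hw : w ∉ G.psdBlue B s) : s + 1 ≤ S.ncard := by
  have key : ∀ i ≤ s, i ≤ (S ∩ G.psdBlue B i).ncard := by
    intro i hi
    induction i with
    | zero => exact Nat.zero_le _
    | succ i ih =>
      refine (Nat.succ_le_succ (ih (by omega))).trans (Set.ncard_lt_ncard ?_ (Set.toFinite _))
      refine ⟨Set.inter_subset_inter_right S (psdBlue_mono_time (Nat.le_succ i)), fun hsub => ?_⟩
      refine hw (psdBlue_mono_time (show i ≤ s by omega) ?_)
      by_cases hit : i ≤ t
      · exact psdBlue_stall hS (fun v hv hv' => (hsub ⟨hv, hv'⟩).2) hit w hwS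
          (by rw [hfin]; trivial)
      · exact psdBlue_mono_time (show t ≤ i by omega) (by rw [hfin]; trivial)
  refine (Nat.succ_le_succ (key s le_rfl)).trans (Set.ncard_lt_ncard ?_ (Set.toFinite _))
  exact ⟨Set.inter_subset_left, fun h => hw (h hwS).2⟩

/-! ### Migration and the bound by half the number of white vertices. -/

/-- Migration: if the propagation from `B` is slow in one component `C` of `G - B` only, then
replacing the first forcing vertices into `C` by the vertices that they force makes it faster. -/
theorem exists_faster_of_migration [Fintype V] {B : Finset V} {C R : Set V}
    (hC : ∀ a ∈ C, ∀ b, b ∉ (B : Set V) → (b ∈ C ↔ G.ReachIn (B : Set V)ᶜ a b))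
    (hR : R = {v | v ∉ C ∧ v ∉ B}) (hCB : Disjoint C (B : Set V)) {t : ℕ}
    (hfin : G.psdBlue (B : Set V) (t + 2) = Set.univ) (hRt : R ⊆ G.psdBlue (B : Set V) t) :
    ∃ B' : Finset V, B'.card = B.card ∧ G.psdBlue (B' : Set V) (t + 1) = Set.univ := by
  classical
  have hCcl : ∀ a ∈ C, ∀ b, G.Adj a b → b ∉ C → b ∈ B := by
    intro a ha b hab hb
    by_contra hbB
    exact hb ((hC a ha b hbB).2 (Relation.ReflTransGen.single ⟨hab, hbB⟩))
  have hRcl : ∀ a ∈ R, ∀ b, G.Adj a b → b ∉ R → b ∈ B := by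
    intro a ha b hab hb
    by_contra hbB
    rw [hR] at ha hb
    have hbC : b ∈ C := by
      by_contra h
      exact hb ⟨h, hbB⟩
    exact ha.2 (hCcl b hbC a hab.symm ha.1)
  -- The new set exchanges `U = f(W)` for `W`. Inside `C` it is one step ahead of `B`; outside it is
  -- at most one step behind, since the reversed forces restore `U` in the first step.
  set W : Finset V := Finset.univ.filter fun w => w ∈ C ∧ w ∈ G.psdBlue (B : Set V) 1 with hW
  have hWforce : ∀ w ∈ W, ∃ u, u ∈ B ∧ G.Adj u w ∧ ∀ v ∈ C, G.Adj u v → v = w := by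
    intro w hw
    simp only [hW, Finset.mem_filter, Finset.mem_univ, true_and] at hw
    obtain ⟨hwC, hw | ⟨u, hu⟩⟩ := hw
    · exact absurd hw (Set.disjoint_left.1 hCB hwC)
    · obtain ⟨h1, h2, h3, h4⟩ := isPSDForce_iff.1 hu
      exact ⟨u, h1, h3, fun v hv =>
        h4 v ((hC w hwC v (Set.disjoint_left.1 hCB hv)).1 hv)⟩
  choose! f hfB hfadj hfuniq using hWforce
  have hWC : ∀ w ∈ W, w ∈ C := fun w hw => by simp [hW] at hw; exact hw.1
  have hinj : Set.InjOn f W := fun w hw w' hw' h =>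
    hfuniq w' hw' w (hWC w hw) (h ▸ hfadj w hw)
  set U := W.image f with hU
  have hUB : U ⊆ B := by
    intro u hu
    obtain ⟨w, hw, rfl⟩ := Finset.mem_image.1 hu
    exact hfB w hw
  have hUadj : ∀ u ∈ U, ∀ a ∈ C, G.Adj u a → a ∈ W ∧ u = f a := by
    intro u hu a ha hua
    obtain ⟨w, hw, rfl⟩ := Finset.mem_image.1 hu
    have := hfuniq w hw a ha hua
    subst this
    exact ⟨hw, rfl⟩
  have hWB : Disjoint (B \ U) W := by
    rw [Finset.disjoint_left]
    intro a ha haW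
    exact Set.disjoint_left.1 hCB (hWC a haW) (Finset.mem_sdiff.1 ha).1
  refine ⟨(B \ U) ∪ W, ?_, ?_⟩
  · rw [Finset.card_union_of_disjoint hWB, Finset.card_sdiff_of_subset hUB,
      Finset.card_image_of_injOn hinj]
    have := Finset.card_le_card hUB
    rw [Finset.card_image_of_injOn hinj] at this
    omega
  set B' : Set V := (((B \ U) ∪ W : Finset V) : Set V) with hB'
  have hmem : ∀ v, v ∈ B' ↔ (v ∈ B ∧ v ∉ U) ∨ v ∈ W := by
    intro v
    simp [hB']
  have hinC : ∀ i, ∀ v ∈ C, v ∈ G.psdBlue (B : Set V) (i + 1) → v ∈ G.psdBlue B' i := by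
    intro i
    induction i with
    | zero =>
      intro v hv hv1
      exact (hmem v).2 (Or.inr (Finset.mem_filter.2 ⟨Finset.mem_univ v, hv, hv1⟩))
    | succ i ih =>
      rintro w hwC (hw | ⟨u, hu⟩)
      · exact Or.inl (ih w hwC hw)
      refine mem_psdBlue_succ_of_force (u := u) fun hw' => ?_
      have hwW : w ∉ W := fun h => hw' (subset_psdBlue B' i ((hmem w).2 (Or.inr h)))
      -- Vertices of `U` have no neighbors in `C \ W`, so giving them up does no harm there.
      refine hu.transfer (S := {v | v ∈ C ∧ v ∉ W}) ?_ (fun a ha => ih a ha.1) ⟨hwC, hwW⟩ hw' ?_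
      · rintro a ⟨haC, haW⟩ b hab hb
        refine subset_psdBlue B' i ((hmem b).2 ?_)
        by_cases hbC : b ∈ C
        · exact Or.inr (by by_contra h; exact hb ⟨hbC, h⟩)
        · exact Or.inl ⟨hCcl a haC b hab hbC, fun hbU => haW (hUadj b hbU a haC hab.symm).1⟩
      · have huw := (isPSDForce_iff.1 hu).2.2.1
        by_cases huC : u ∈ C
        · exact ih u huC hu.1
        · exact subset_psdBlue B' i ((hmem u).2 (Or.inl ⟨hCcl w hwC u huw.symm huC,
            fun huU => hwW (hUadj u huU w hwC huw).1⟩))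
  have hB1 : (B : Set V) ⊆ G.psdBlue B' 1 := by
    intro u huB
    by_cases huU : u ∈ U
    swap
    · exact Or.inl ((hmem u).2 (Or.inl ⟨huB, huU⟩))
    obtain ⟨w, hw, rfl⟩ := Finset.mem_image.1 huU
    refine mem_psdBlue_succ_of_force (u := w) fun hu' => isPSDForce_iff.2
      ⟨(hmem w).2 (Or.inr hw), hu', (hfadj w hw).symm, fun v hv hwv => ?_⟩
    -- With `C` cut off by `W`, the white component of `f w` stays in `U ∪ R`; there `w` is adjacent
    -- to `f w` only.
    have hvS : v ∈ {v | v ∈ U ∨ v ∈ R} := by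
      refine hv.mem_of_closed (Or.inl huU) ?_
      rintro a ha b hab hb
      have hb' := mt (hmem b).2 hb
      push Not at hb'
      by_cases hbC : b ∈ C
      · rcases ha with ha | ha
        · exact absurd (hUadj a ha b hbC hab).1 hb'.2
        · rw [hR] at ha
          exact absurd (hCcl b hbC a hab.symm ha.1) ha.2
      · by_cases hbB : b ∈ B
        · exact Or.inl (hb'.1 hbB)
        · exact Or.inr (by rw [hR]; exact ⟨hbC, hbB⟩)
    rcases hvS with hvU | hvR
    · exact (hUadj v hvU w (hWC w hw) hwv.symm).2
    · rw [hR] at hvR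
      exact absurd (hCcl w (hWC w hw) v hwv hvR.1) hvR.2
  have hinR : ∀ i, ∀ v ∈ R, v ∈ G.psdBlue (B : Set V) i → v ∈ G.psdBlue B' (i + 1) := by
    intro i
    induction i with
    | zero =>
      intro v hv hvB
      rw [hR] at hv
      exact absurd hvB hv.2
    | succ i ih =>
      have hBi : (B : Set V) ⊆ G.psdBlue B' (i + 1) := hB1.trans (psdBlue_mono_time (by omega))
      rintro w hwR (hw | ⟨u, hu⟩)
      · exact Or.inl (ih w hwR hw)
      refine mem_psdBlue_succ_of_force (u := u) fun hw' => hu.transfer (S := R)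
        (fun a ha b hab hb => hBi (hRcl a ha b hab hb)) ih hwR hw' ?_
      by_cases huR : u ∈ R
      · exact ih u huR hu.1
      · exact hBi (hRcl w hwR u (isPSDForce_iff.1 hu).2.2.1.symm huR)
  rw [Set.eq_univ_iff_forall]
  intro v
  by_cases hvC : v ∈ C
  · exact hinC (t + 1) v hvC (by rw [hfin]; trivial)
  by_cases hvB : v ∈ B
  · exact psdBlue_mono_time (by omega) (hB1 hvB)
  · have hvR : v ∈ R := by rw [hR]; exact ⟨hvC, hvB⟩
    exact hinR t v hvR (hRt hvR)

theorem psdForcingNumber_spec [Fintype V] (G : SimpleGraph V) :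
    ∃ B : Finset V, B.card = G.psdForcingNumber ∧ G.IsPSDForcingSet B :=
  Nat.sInf_mem (s := {m : ℕ | ∃ B : Finset V, B.card = m ∧ G.IsPSDForcingSet B})
    ⟨_, Finset.univ, rfl, 0, by simp [psdBlue]⟩

theorem IsPSDForcingSet.psdForcingNumber_le {B : Finset V} (h : G.IsPSDForcingSet B) :
    G.psdForcingNumber ≤ B.card :=
  Nat.sInf_le ⟨B, rfl, h⟩

theorem psdPropTime_le {B : Finset V} {t : ℕ} (hB : B.card = G.psdForcingNumber)
    (ht : G.psdBlue (B : Set V) t = Set.univ) : G.psdPropTime ≤ t :=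
  (iInf₂_le B hB).trans (iInf₂_le t ht)

theorem le_psdPropTime {s : ℕ} (h : ∀ (B : Finset V) (t : ℕ), B.card = G.psdForcingNumber →
    G.psdBlue (B : Set V) t = Set.univ → s ≤ t) : (s : ℕ∞) ≤ G.psdPropTime :=
  le_iInf₂ fun B hB => le_iInf₂ fun t ht => by exact_mod_cast h B t hB ht

/-- The bound `pt₊(G) ≤ ⌈(n - Z₊(G)) / 2⌉`. -/
theorem exists_psdPropTime_le [Fintype V] (G : SimpleGraph V) :
    ∃ t : ℕ, G.psdPropTime ≤ t ∧ 2 * t + G.psdForcingNumber ≤ Fintype.card V + 1 := by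
  classical
  have hex : ∃ t : ℕ, ∃ B : Finset V, B.card = G.psdForcingNumber ∧
      G.psdBlue (B : Set V) t = Set.univ := by
    obtain ⟨B, hB, t, ht⟩ := psdForcingNumber_spec G
    exact ⟨t, B, hB, ht⟩
  obtain ⟨B, hB, ht⟩ := Nat.find_spec hex
  have hmin : ∀ s < Nat.find hex, ∀ B' : Finset V, B'.card = G.psdForcingNumber →
      G.psdBlue (B' : Set V) s ≠ Set.univ := fun s hs B' hB' h => Nat.find_min hex hs ⟨B', hB', h⟩
  generalize Nat.find hex = t at ht hmin
  refine ⟨t, psdPropTime_le hB ht, ?_⟩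
  rw [← hB]
  have hBc : B.card ≤ Fintype.card V := Finset.card_le_univ B
  rcases t with _ | t
  · omega
  obtain ⟨w, hw⟩ := (Set.ne_univ_iff_exists_notMem _).1 (hmin t (by omega) B hB)
  have hwB : w ∉ (B : Set V) := fun h => hw (subset_psdBlue _ t h)
  set C : Set V := {v | G.ReachIn (B : Set V)ᶜ w v} with hCdef
  have hCB : ∀ v ∈ C, v ∉ (B : Set V) := fun v hv => ReachIn.mem hv hwB
  have hC : ∀ a ∈ C, ∀ b, b ∉ (B : Set V) → (b ∈ C ↔ G.ReachIn (B : Set V)ᶜ a b) :=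
    fun a ha b hb => ⟨fun h => (ReachIn.symm ha hwB).trans h, fun h => ReachIn.mem_of_closed h ha
      fun x hx y hxy hy => Relation.ReflTransGen.tail hx ⟨hxy, hy⟩⟩
  have hCcl : ∀ a ∈ C, ∀ b, G.Adj a b → b ∉ C → b ∈ (B : Set V) := by
    intro a ha b hab hb
    by_contra hbB
    exact hb (Relation.ReflTransGen.tail ha ⟨hab, hbB⟩)
  have hdisj : Disjoint C (B : Set V) := Set.disjoint_left.2 hCB
  have hCcard := le_ncard_of_late hCcl ht (show w ∈ C from .refl) hw
  set R : Set V := {v | v ∉ C ∧ v ∉ B} with hR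
  have hRdisj : Disjoint R (B : Set V) := Set.disjoint_left.2 fun v hv => hv.2
  have hRcl : ∀ a ∈ R, ∀ b, G.Adj a b → b ∉ R → b ∈ (B : Set V) := by
    intro a ha b hab hb
    by_contra hbB
    exact ha.2 (hCcl b (by by_contra h; exact hb ⟨h, hbB⟩) a hab.symm ha.1)
  -- The minimal time is now `t + 1`, so migration excludes that `R` is blue at time `t - 1`.
  have hRcard : t ≤ R.ncard := by
    rcases t with _ | t
    · exact Nat.zero_le _
    have : ¬ R ⊆ G.psdBlue (B : Set V) t := by
      intro h
      obtain ⟨B', hB', h'⟩ := exists_faster_of_migration hC hR hdisj ht h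
      exact hmin (t + 1) (by omega) B' (hB'.trans hB) h'
    obtain ⟨v, hvR, hv⟩ := Set.not_subset.1 this
    exact le_ncard_of_late hRcl ht hvR hv
  have hCR : Disjoint C R := Set.disjoint_left.2 fun v hv hv' => hv'.1 hv
  have h1 := Set.ncard_union_eq hCR (Set.toFinite _) (Set.toFinite _)
  have h2 := Set.ncard_union_eq (Set.disjoint_union_left.2 ⟨hdisj, hRdisj⟩) (Set.toFinite _)
    (Set.toFinite _)
  have h3 := Set.ncard_le_card (C ∪ R ∪ (B : Set V))
  rw [Set.ncard_coe_finset] at h2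
  rw [Nat.card_eq_fintype_card] at h3
  omega

/-! ### Sum of the forcing numbers of a graph and its complement. -/

/-- `C` is connected in `G`, in the sense that any two of its vertices are joined within `C`. -/
def ConnectedOn (G : SimpleGraph V) (C : Set V) : Prop :=
  ∀ a ∈ C, ∀ b ∈ C, G.ReachIn C a b

theorem connectedOn_setOf_reachIn (A : Set V) (w : V) :
    G.ConnectedOn {v | G.ReachIn A w v} := by
  have key : ∀ v, G.ReachIn A w v → G.ReachIn {v | G.ReachIn A w v} w v := by
    intro v hv
    induction hv with
    | refl => exact .refl
    | tail h hab ih => exact ih.tail ⟨hab.1, Relation.ReflTransGen.tail h hab⟩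
  exact fun a ha b hb => ((key a ha).symm .refl).trans (key b hb)

/-- Look at the first force into `C`: until then `C` is white and lies in one white component. -/
theorem ConnectedOn.exists_unique_adj {B : Set V} {t : ℕ} (hB : G.psdBlue B t = Set.univ)
    {C : Set V} (hC : G.ConnectedOn C) (hne : C.Nonempty) (hCB : Disjoint C B) :
    ∃ u, u ∉ C ∧ ∃ w ∈ C, G.Adj u w ∧ ∀ v ∈ C, G.Adj u v → v = w := by
  by_contra hcon
  have key : ∀ i, Disjoint C (G.psdBlue B i) := by
    intro i
    induction i with
    | zero => exact hCB
    | succ i ih =>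
      rw [Set.disjoint_left] at ih ⊢
      rintro w hwC (hw | ⟨u, hu⟩)
      · exact ih hwC hw
      · obtain ⟨h1, _, h3, h4⟩ := isPSDForce_iff.1 hu
        exact hcon ⟨u, fun huC => ih huC h1, w, hwC, h3,
          fun v hv => h4 v ((hC w hwC v hv).mono fun x hx => ih hx)⟩
  obtain ⟨w, hw⟩ := hne
  exact Set.disjoint_left.1 (key t) hw (by rw [hB]; trivial)

/-- The forces can be performed one after the other. -/
theorem exists_forcing_order [Fintype V] {B : Set V} {t : ℕ} (hB : G.psdBlue B t = Set.univ) :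
    ∃ f : V → ℕ, Function.Injective f ∧ (∀ b ∈ B, ∀ v ∉ B, f b < f v) ∧
      ∀ v ∉ B, ∃ u, f u < f v ∧ G.Adj u v ∧
        ∀ x, G.ReachIn {x | f v ≤ f x} v x → G.Adj u x → x = v := by
  classical
  have hex : ∀ v, ∃ i, v ∈ G.psdBlue B i := fun v => ⟨t, by rw [hB]; trivial⟩
  set τ : V → ℕ := fun v => Nat.find (hex v) with hτ
  have hτle : ∀ v i, v ∈ G.psdBlue B i ↔ τ v ≤ i := fun v i =>
    ⟨fun h => Nat.find_min' (hex v) h, fun h => psdBlue_mono_time h (Nat.find_spec (hex v))⟩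
  set n := Fintype.card V
  let e := Fintype.equivFin V
  have hlt : ∀ a b, τ a < τ b → n * τ a + (e a : ℕ) < n * τ b + (e b : ℕ) := by
    intro a b hab
    have h1 : n * (τ a + 1) ≤ n * τ b := Nat.mul_le_mul_left n hab
    have h2 := (e a).2
    rw [Nat.mul_add, Nat.mul_one] at h1
    omega
  have hτB : ∀ v, v ∈ B ↔ τ v = 0 := fun v => by
    rw [← Nat.le_zero, ← hτle]
    rfl
  -- Order by the time `τ` of turning blue; ties are broken by `e v < n`.
  refine ⟨fun v => n * τ v + (e v : ℕ), ?_, ?_, ?_⟩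
  · intro a b hab
    have hab' : n * τ a + (e a : ℕ) = n * τ b + (e b : ℕ) := hab
    rcases lt_trichotomy (τ a) (τ b) with h | h | h
    · exact absurd hab' (hlt a b h).ne
    · rw [h] at hab'
      exact e.injective (Fin.ext (by omega))
    · exact absurd hab' (hlt b a h).ne'
  · intro b hb v hv
    rw [hτB] at hb hv
    exact hlt b v (by omega)
  · intro v hv
    rw [hτB] at hv
    obtain ⟨s, hs⟩ := Nat.exists_eq_succ_of_ne_zero hv
    rcases (hτle v (s + 1)).2 (by omega) with h | ⟨u, hu⟩
    · rw [hτle] at h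
      omega
    · obtain ⟨h1, h2, h3, h4⟩ := isPSDForce_iff.1 hu
      rw [hτle] at h1
      refine ⟨u, hlt u v (by omega), h3, fun x hx => h4 x (hx.mono ?_)⟩
      intro y hy hy'
      rw [hτle] at hy'
      exact absurd (hlt y v (by omega)) (not_lt.2 hy)

/-- A graph with a PSD forcing set of `k` vertices has a chordal supergraph without cliques of
`k + 2` vertices. Of chordality, the statement records that there is no induced 4-cycle. -/
theorem exists_chordal_supergraph [Fintype V] {B : Finset V} (hB : G.IsPSDForcingSet B) :
    ∃ H : SimpleGraph V, G ≤ H ∧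
      (∀ K : Finset V, (∀ a ∈ K, ∀ b ∈ K, a ≠ b → H.Adj a b) → K.card ≤ B.card + 1) ∧
      ∀ p q r s, H.Adj p r → H.Adj p s → H.Adj q r → H.Adj q s → p ≠ q → r ≠ s →
        H.Adj p q ∨ H.Adj r s := by
  classical
  obtain ⟨t, ht⟩ := hB
  obtain ⟨f, hf, hfB, hforce⟩ := exists_forcing_order ht
  -- `N v` consists of the earlier vertices with a neighbor in the component of `v` among the
  -- vertices not earlier than `v`.
  set N : V → V → Prop := fun v y =>
    f y < f v ∧ ∃ x, G.ReachIn {x | f v ≤ f x} v x ∧ G.Adj x y with hN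
  have hself : ∀ v, v ∈ {x | f v ≤ f x} := fun v => le_refl (f v)
  have hNcard : ∀ m, ∀ v, f v = m → v ∉ B → (Finset.univ.filter (N v)).card ≤ B.card := by
    intro m
    induction m using Nat.strong_induction_on with
    | _ m ih =>
      rintro v rfl hv
      by_cases hNB : ∀ y, N v y → y ∈ B
      · exact Finset.card_le_card fun y hy => hNB y (by simpa using hy)
      push Not at hNB
      have hne : (Finset.univ.filter fun y => N v y ∧ y ∉ B).Nonempty := by
        obtain ⟨y, hy⟩ := hNB
        exact ⟨y, by simpa using hy⟩
      -- For the latest `w` in `N v` outside `B`, forced by `u`, the component of `w` contains that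
      -- of `v`. So `N v ⊆ {w} ∪ (N w \ {u})`: the only neighbor of `u` in the component of `w` is
      -- `w` itself.
      obtain ⟨w, hw, hmax⟩ := Finset.exists_max_image _ f hne
      simp only [Finset.mem_filter, Finset.mem_univ, true_and] at hw hmax
      obtain ⟨⟨hwv, x, hx, hxw⟩, hwB⟩ := hw
      have hsub : ∀ z, G.ReachIn {x | f v ≤ f x} v z → G.ReachIn {x | f w ≤ f x} w z := by
        intro z hz
        have h1 : G.ReachIn {x | f v ≤ f x} x z := (hx.symm (hself v)).trans hz
        refine Relation.ReflTransGen.head ⟨hxw.symm, ?_⟩ (h1.mono fun y hy => ?_)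
        · exact hwv.le.trans (hx.mem (hself v))
        · exact hwv.le.trans hy
      obtain ⟨u, huw, huadj, huniq⟩ := hforce w hwB
      have huN : N w u := ⟨huw, w, .refl, huadj.symm⟩
      have hsubset : Finset.univ.filter (N v) ⊆
          insert w ((Finset.univ.filter (N w)).erase u) := by
        intro y hy
        simp only [Finset.mem_filter, Finset.mem_univ, true_and, Finset.mem_insert,
          Finset.mem_erase] at hy ⊢
        by_cases hyw : y = w
        · exact Or.inl hyw
        obtain ⟨hyv, z, hz, hzy⟩ := hy
        refine Or.inr ⟨?_, ?_, z, hsub z hz, hzy⟩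
        · rintro rfl
          have hzw := huniq z (hsub z hz) hzy.symm
          subst hzw
          exact absurd (hz.mem (hself v)) (not_le.2 hwv)
        · by_cases hyB : y ∈ B
          · exact hfB y hyB w hwB
          · exact lt_of_le_of_ne (hmax y ⟨⟨hyv, z, hz, hzy⟩, hyB⟩) (hf.ne hyw)
      have hu : u ∈ Finset.univ.filter (N w) := by simpa using huN
      have h1 := Finset.card_le_card hsubset
      have h2 := Finset.card_insert_le w ((Finset.univ.filter (N w)).erase u)
      have h3 := Finset.card_erase_of_mem hu
      have h4 := Finset.card_pos.2 ⟨u, hu⟩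
      have h5 := ih (f w) hwv w rfl hwB
      omega
  -- In `H` the set `B` becomes a clique and each other `a` is joined to `N a`. The earlier
  -- neighbors of any vertex then form a clique (`hRtri`), a perfect elimination order read
  -- backwards.
  set R : V → V → Prop := fun a b => f b < f a ∧ (a ∈ B ∨ N a b) with hR
  have hRB : ∀ a b, R a b → a ∈ B → b ∈ B := by
    intro a b hab ha
    by_contra hb
    exact absurd (hfB a ha b hb) (not_lt.2 hab.1.le)
  have hRcard : ∀ a, (Finset.univ.filter (R a)).card ≤ B.card := by
    intro a
    by_cases ha : a ∈ B
    · exact Finset.card_le_card fun y hy => hRB a y (by simpa using hy) ha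
    · refine le_trans (Finset.card_le_card fun y hy => ?_) (hNcard _ a rfl ha)
      simp only [Finset.mem_filter, Finset.mem_univ, true_and] at hy ⊢
      exact hy.2.resolve_left ha
  have hRtri : ∀ a b c, R a b → R a c → f c < f b → R b c := by
    intro a b c hab hac hcb
    refine ⟨hcb, ?_⟩
    by_cases hb : b ∈ B
    · exact Or.inl hb
    have ha : a ∉ B := fun ha => hb (hRB a b hab ha)
    obtain ⟨hba, x, hx, hxb⟩ := hab.2.resolve_left ha
    obtain ⟨hca, y, hy, hyc⟩ := hac.2.resolve_left ha
    refine Or.inr ⟨hcb, y, ?_, hyc⟩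
    have h1 : G.ReachIn {x | f a ≤ f x} x y := (hx.symm (hself a)).trans hy
    refine Relation.ReflTransGen.head ⟨hxb.symm, ?_⟩ (h1.mono fun z hz => hba.le.trans hz)
    exact hba.le.trans (hx.mem (hself a))
  have hGR : ∀ a b, G.Adj a b → f b < f a → R a b :=
    fun a b hab h => ⟨h, Or.inr ⟨h, a, .refl, hab⟩⟩
  let H : SimpleGraph V :=
    { Adj := fun a b => R a b ∨ R b a
      symm := ⟨fun a b h => h.symm⟩
      loopless := ⟨fun a h => by rcases h with h | h <;> exact lt_irrefl _ h.1⟩ }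
  have hH : ∀ a b, H.Adj a b ↔ R a b ∨ R b a := fun a b => Iff.rfl
  have hHR : ∀ a b, H.Adj a b → f b < f a → R a b := fun a b hab h =>
    hab.resolve_right fun h' => lt_asymm h h'.1
  have htop : ∀ p q r, H.Adj p q → H.Adj p r → f q < f p → f r < f p → q ≠ r → H.Adj q r := by
    intro p q r hpq hpr hq hr hqr
    rcases lt_or_gt_of_ne (hf.ne hqr) with h | h
    · exact Or.inr (hRtri p r q (hHR p r hpr hr) (hHR p q hpq hq) h)
    · exact Or.inl (hRtri p q r (hHR p q hpq hq) (hHR p r hpr hr) h)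
  refine ⟨H, fun a b hab => ?_, fun K hK => ?_, fun p q r s hpr hps hqr hqs hpq hrs => ?_⟩
  · rcases lt_or_gt_of_ne (hf.ne hab.ne) with h | h
    · exact Or.inr (hGR b a hab.symm h)
    · exact Or.inl (hGR a b hab h)
  · rcases K.eq_empty_or_nonempty with rfl | hne
    · simp
    obtain ⟨a, ha, hmax⟩ := Finset.exists_max_image K f hne
    have hsub : K.erase a ⊆ Finset.univ.filter (R a) := by
      intro b hb
      obtain ⟨hba, hb⟩ := Finset.mem_erase.1 hb
      simp only [Finset.mem_filter, Finset.mem_univ, true_and]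
      exact hHR a b (hK a ha b hb hba.symm) (lt_of_le_of_ne (hmax b hb) (hf.ne hba))
    have h1 := Finset.card_le_card hsub
    rw [Finset.card_erase_of_mem ha] at h1
    have := hRcard a
    omega
  · have h1 := hf.ne hpr.ne
    have h2 := hf.ne hps.ne
    have h3 := hf.ne hqr.ne
    have h4 := hf.ne hqs.ne
    have h5 := hf.ne hpq
    have h6 := hf.ne hrs
    -- The latest vertex of the 4-cycle has two earlier neighbors on it, and these are adjacent.
    by_cases hp : f r < f p ∧ f s < f p
    · exact Or.inr (htop p r s hpr hps hp.1 hp.2 hrs)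
    by_cases hq : f r < f q ∧ f s < f q
    · exact Or.inr (htop q r s hqr hqs hq.1 hq.2 hrs)
    by_cases hr : f p < f r ∧ f q < f r
    · exact Or.inl (htop r p q hpr.symm hqr.symm hr.1 hr.2 hpq)
    · exact Or.inl (htop s p q hps.symm hqs.symm (by omega) (by omega) hpq)

/-- The Nordhaus–Gaddum lower bound for the PSD forcing number. -/
theorem card_le_psdForcingNumber_add_compl [Fintype V] (G : SimpleGraph V) :
    Fintype.card V ≤ G.psdForcingNumber + Gᶜ.psdForcingNumber + 2 := by
  classical
  obtain ⟨B, hBcard, hB⟩ := psdForcingNumber_spec G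
  obtain ⟨B', hB'card, t, hB'⟩ := psdForcingNumber_spec Gᶜ
  rw [← hBcard, ← hB'card]
  obtain ⟨H, hGH, hclique, hchord⟩ := exists_chordal_supergraph hB
  by_contra hcon
  -- Outside `P` there remain at least `B.card + 2` vertices, too many for a clique of `H`.
  have hedge : ∀ P : Finset V, P.card ≤ B'.card + 1 →
      ∃ a b, a ≠ b ∧ ¬ H.Adj a b ∧ a ∉ P ∧ b ∉ P := by
    intro P hP
    by_contra h
    push Not at h
    have := hclique Pᶜ fun a ha b hb hab => by
      by_contra hadj
      exact Finset.mem_compl.1 hb (h a b hab hadj (Finset.mem_compl.1 ha))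
    rw [Finset.card_compl] at this
    omega
  have hGc : ∀ a b, a ≠ b → ¬ H.Adj a b → Gᶜ.Adj a b := fun a b hab h =>
    (compl_adj _ _ _).2 ⟨hab, fun h' => h (hGH h')⟩
  -- Descent on connected sets `C` of `Gᶜ` that avoid `B'`, have their boundary in a set `P` of at
  -- most `B'.card` vertices, and contain a non-edge of `H`.
  have descent : ∀ m, ∀ C P : Finset V, C.card = m → P.card ≤ B'.card → Disjoint C P →
      (∀ a ∈ C, ∀ b, Gᶜ.Adj a b → b ∉ C → b ∈ P) → Disjoint C B' →
      Gᶜ.ConnectedOn (C : Set V) → (∃ a ∈ C, ∃ b ∈ C, a ≠ b ∧ ¬ H.Adj a b) → False := by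
    intro m
    induction m using Nat.strong_induction_on with
    | _ m ih =>
      rintro C P rfl hP hCP hbd hCB hconn ⟨p, hp, q, hq, hpq, hpqH⟩
      obtain ⟨u, huC, w, hwC, huw, huniq⟩ := hconn.exists_unique_adj hB' ⟨p, hp⟩
        (by exact_mod_cast hCB)
      have huP : u ∈ P := hbd w hwC u huw.symm huC
      have hwP : w ∉ P := Finset.disjoint_left.1 hCP hwC
      obtain ⟨r, s, hrs, hrsH, hr, hs⟩ := hedge (insert w P)
        ((Finset.card_insert_le _ _).trans (by omega))
      simp only [Finset.mem_insert, not_or] at hr hs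
      have hstep : ∀ a ∈ C, ∀ b, b ∉ P → Gᶜ.Adj a b → b ∈ C := fun a ha b hb hab => by
        by_contra h
        exact hb (hbd a ha b hab h)
      -- Otherwise `p, q` in `C` and `r, s` outside `C ∪ P` would span an induced 4-cycle of `H`, as
      -- `Gᶜ` has no edge between the two sides.
      have hrC : r ∈ C := by
        by_contra hrC
        have hsC : s ∉ C := fun h => hrC (hstep s h r hr.2 (hGc _ _ hrs hrsH).symm)
        have hadj : ∀ x ∈ C, ∀ y, y ∉ C → y ∉ P → H.Adj x y := fun x hx y hy hyP => by
          by_contra h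
          exact hy (hstep x hx y hyP (hGc x y (by rintro rfl; exact hy hx) h))
        exact (hchord p q r s (hadj p hp r hrC hr.2) (hadj p hp s hsC hs.2)
          (hadj q hq r hrC hr.2) (hadj q hq s hsC hs.2) hpq hrs).elim hpqH hrsH
      have hsC : s ∈ C := hstep r hrC s hs.2 (hGc _ _ hrs hrsH)
      set A : Set V := {x | x ∈ C ∧ x ≠ w} with hA
      set D : Finset V := Finset.univ.filter fun x => Gᶜ.ReachIn A r x with hD
      have hmemD : ∀ x, x ∈ D ↔ Gᶜ.ReachIn A r x := by simp [hD]
      have hrA : r ∈ A := ⟨hrC, hr.1⟩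
      have hDA : ∀ x ∈ D, x ∈ C ∧ x ≠ w := fun x hx => ((hmemD x).1 hx).mem hrA
      have hDC : D ⊆ C := fun x hx => (hDA x hx).1
      -- Removing `w` adds it to the boundary but frees `u`, whose only neighbor in `C` was `w`, so
      -- the bound on `P` persists.
      refine ih D.card ?_ D (insert w (P.erase u)) rfl ?_ ?_ ?_ ?_ ?_ ⟨r, ?_, s, ?_, hrs, hrsH⟩
      · exact Finset.card_lt_card ⟨hDC, fun h => (hDA w (h hwC)).2 rfl⟩
      · refine (Finset.card_insert_le _ _).trans ?_
        rw [Finset.card_erase_of_mem huP]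
        have := Finset.card_pos.2 ⟨u, huP⟩
        omega
      · rw [Finset.disjoint_left]
        intro x hx hx'
        rcases Finset.mem_insert.1 hx' with h | h
        · exact (hDA x hx).2 h
        · exact Finset.disjoint_left.1 hCP (hDC hx) (Finset.mem_of_mem_erase h)
      · intro a ha b hab hb
        rw [Finset.mem_insert, Finset.mem_erase]
        by_cases hbw : b = w
        · exact Or.inl hbw
        have hbC : b ∉ C := fun h => hb ((hmemD b).2
          (Relation.ReflTransGen.tail ((hmemD a).1 ha) ⟨hab, h, hbw⟩))
        refine Or.inr ⟨?_, hbd a (hDC ha) b hab hbC⟩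
        rintro rfl
        exact (hDA a ha).2 (huniq a (hDC ha) hab.symm)
      · exact Finset.disjoint_of_subset_left hDC hCB
      · have := connectedOn_setOf_reachIn (G := Gᶜ) A r
        convert this using 1
        ext x
        exact hmemD x
      · exact (hmemD r).2 .refl
      · exact (hmemD s).2 (Relation.ReflTransGen.single ⟨hGc _ _ hrs hrsH, hsC, hs.1⟩)
  obtain ⟨a, b, hab, habH, ha, hb⟩ := hedge B' (Nat.le_succ _)
  set D : Finset V := Finset.univ.filter fun x => Gᶜ.ReachIn (B' : Set V)ᶜ a x with hD
  have hmemD : ∀ x, x ∈ D ↔ Gᶜ.ReachIn (B' : Set V)ᶜ a x := by simp [hD]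
  have haA : a ∈ (B' : Set V)ᶜ := ha
  have hDB : Disjoint D B' := Finset.disjoint_left.2 fun x hx => ((hmemD x).1 hx).mem haA
  refine descent D.card D B' rfl le_rfl hDB ?_ hDB ?_ ⟨a, ?_, b, ?_, hab, habH⟩
  · intro x hx y hxy hy
    by_contra hyB
    exact hy ((hmemD y).2 (Relation.ReflTransGen.tail ((hmemD x).1 hx) ⟨hxy, hyB⟩))
  · have := connectedOn_setOf_reachIn (G := Gᶜ) (B' : Set V)ᶜ a
    convert this using 1
    ext x
    exact hmemD x
  · exact (hmemD a).2 .refl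
  · exact (hmemD b).2 (Relation.ReflTransGen.single ⟨hGc _ _ hab habH, hb⟩)

/-! ### The two general bounds, complete graphs, and a zero forcing criterion. -/

theorem natCast_le_half_add_two {m n : ℕ} (h : 2 * m ≤ n + 4) :
    (m : ℝ≥0∞) ≤ (n : ℝ≥0∞) / 2 + 2 := by
  have h2 : (2 : ℝ≥0∞) = 4 / 2 := by
    rw [ENNReal.eq_div_iff (by norm_num) (by norm_num)]
    norm_num
  rw [h2, ← h2, show (n : ℝ≥0∞) / 2 + 2 = ((n + 4 : ℕ) : ℝ≥0∞) / 2 by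
    rw [Nat.cast_add, ENNReal.add_div, Nat.cast_ofNat, ← h2],
    ENNReal.le_div_iff_mul_le (by simp) (by simp)]
  calc (m : ℝ≥0∞) * 2 = ((2 * m : ℕ) : ℝ≥0∞) := by push_cast; ring
    _ ≤ _ := by exact_mod_cast h

theorem exists_psdPropTime_add_compl_le [Fintype V] (G : SimpleGraph V) :
    ∃ m : ℕ, G.psdPropTime + Gᶜ.psdPropTime ≤ m ∧ 2 * m ≤ Fintype.card V + 4 := by
  obtain ⟨s, hs, hs'⟩ := exists_psdPropTime_le G
  obtain ⟨t, ht, ht'⟩ := exists_psdPropTime_le Gᶜ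
  have := card_le_psdForcingNumber_add_compl G
  exact ⟨s + t, by push_cast; exact add_le_add hs ht, by omega⟩

theorem psdForcingNumber_add_one_le [Fintype V] {u w : V} (h : G.Adj u w) :
    G.psdForcingNumber + 1 ≤ Fintype.card V := by
  classical
  have : G.IsPSDForcingSet (Finset.univ.erase w) := by
    refine ⟨1, Set.eq_univ_of_forall fun v => ?_⟩
    by_cases hv : v = w
    · subst hv
      refine mem_psdBlue_succ_of_force (u := u) fun hv => isPSDForce_iff.2
        ⟨by simpa [psdBlue] using h.ne, hv, h, fun y hy _ => ?_⟩
      simpa [psdBlue] using hy.mem hv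
    · exact subset_psdBlue _ 1 (by simpa using hv)
  have h1 := this.psdForcingNumber_le
  rw [Finset.card_erase_of_mem (Finset.mem_univ w), Finset.card_univ] at h1
  have := Fintype.card_pos_iff.2 ⟨w⟩
  omega

theorem one_le_psdPropTime [Fintype V] {u w : V} (h : G.Adj u w) : 1 ≤ G.psdPropTime := by
  refine mod_cast le_psdPropTime (s := 1) fun B t hB ht => Nat.one_le_iff_ne_zero.2 ?_
  rintro rfl
  have h1 := psdForcingNumber_add_one_le h
  have h2 : B = Finset.univ := by
    rw [← Finset.coe_eq_univ]
    exact ht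
  rw [← hB, h2, Finset.card_univ] at h1
  omega

theorem one_le_psdPropTime_add_compl [Fintype V] (G : SimpleGraph V) (h : 2 ≤ Fintype.card V) :
    1 ≤ G.psdPropTime + Gᶜ.psdPropTime := by
  obtain ⟨a, b, hab⟩ := Fintype.exists_pair_of_one_lt_card h
  by_cases hadj : G.Adj a b
  · exact (one_le_psdPropTime hadj).trans le_self_add
  · exact (one_le_psdPropTime ((compl_adj _ _ _).2 ⟨hab, hadj⟩)).trans le_add_self

theorem psdPropTime_bot [Fintype V] : (⊥ : SimpleGraph V).psdPropTime = 0 := by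
  obtain ⟨B, hB, t, ht⟩ := psdForcingNumber_spec (⊥ : SimpleGraph V)
  have hstay : ∀ i, (⊥ : SimpleGraph V).psdBlue (B : Set V) i = B := by
    intro i
    induction i with
    | zero => rfl
    | succ i ih =>
      refine subset_antisymm ?_ (subset_psdBlue _ _)
      rintro w (hw | ⟨u, hu⟩)
      · rwa [ih] at hw
      · exact absurd (isPSDForce_iff.1 hu).2.2.1 (by simp)
  exact le_antisymm (by exact_mod_cast psdPropTime_le (t := 0) hB ((hstay t).symm.trans ht))
    bot_le

/-- Two white vertices of a complete graph block each other, since every blue vertex sees both. -/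
theorem card_le_psdForcingNumber_top [Fintype V] :
    Fintype.card V ≤ (⊤ : SimpleGraph V).psdForcingNumber + 1 := by
  classical
  obtain ⟨B, hB, t, ht⟩ := psdForcingNumber_spec (⊤ : SimpleGraph V)
  by_contra hcon
  have hcard : 1 < Bᶜ.card := by
    rw [Finset.card_compl]
    omega
  obtain ⟨a, ha, b, hb, hab⟩ := Finset.one_lt_card.1 hcard
  rw [Finset.mem_compl] at ha hb
  have hconn : (⊤ : SimpleGraph V).ConnectedOn (B : Set V)ᶜ := fun x hx y hy => by
    by_cases hxy : x = y
    · subst hxy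
      exact .refl
    · exact Relation.ReflTransGen.single ⟨hxy, hy⟩
  obtain ⟨u, hu, w, hw, -, huniq⟩ := hconn.exists_unique_adj ht ⟨a, ha⟩ disjoint_compl_left
  have hadj : ∀ v, v ∉ B → (⊤ : SimpleGraph V).Adj u v := fun v hv => by
    rw [top_adj]
    rintro rfl
    exact hu hv
  exact hab ((huniq a ha (hadj a ha)).trans (huniq b hb (hadj b hb)).symm)

theorem psdPropTime_top [Fintype V] (h : 2 ≤ Fintype.card V) :
    (⊤ : SimpleGraph V).psdPropTime = 1 := by
  obtain ⟨a, b, hab⟩ := Fintype.exists_pair_of_one_lt_card h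
  obtain ⟨t, ht, ht'⟩ := exists_psdPropTime_le (⊤ : SimpleGraph V)
  have := card_le_psdForcingNumber_top (V := V)
  exact le_antisymm (ht.trans (by exact_mod_cast (by omega : t ≤ 1)))
    (one_le_psdPropTime (G := ⊤) (top_adj a b |>.2 hab))

theorem exists_forall_mem_psdBlue [Finite V] (B : Set V) :
    ∃ T, ∀ v t, v ∈ G.psdBlue B t → v ∈ G.psdBlue B T := by
  classical
  have := Fintype.ofFinite V
  have h : ∀ v, ∃ s, ∀ t, v ∈ G.psdBlue B t → v ∈ G.psdBlue B s := fun v => by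
    by_cases hv : ∃ t, v ∈ G.psdBlue B t
    · exact hv.imp fun s hs _ _ => hs
    · exact ⟨0, fun t ht => absurd ⟨t, ht⟩ hv⟩
  choose s hs using h
  exact ⟨Finset.univ.sup s, fun v t hv => psdBlue_mono_time
    (Finset.le_sup (Finset.mem_univ v)) (hs v t hv)⟩

/-- To show that `B` is a PSD forcing set it is enough to use zero forcing, that is, to force
unique white neighbors. -/
theorem isPSDForcingSet_of_closed [Finite V] {B : Finset V}
    (h : ∀ K : Set V, (∀ v ∈ B, v ∈ K) →
      (∀ u ∈ K, ∀ w, G.Adj u w → (∀ v, G.Adj u v → v ≠ w → v ∈ K) → w ∈ K) → ∀ v, v ∈ K) :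
    G.IsPSDForcingSet B := by
  obtain ⟨T, hT⟩ := exists_forall_mem_psdBlue (G := G) (B : Set V)
  refine ⟨T, Set.eq_univ_of_forall (h _ (fun v hv => subset_psdBlue _ _ hv) ?_)⟩
  intro u hu w huw hv
  refine hT w (T + 1) (mem_psdBlue_succ_of_force (u := u) fun hw => isPSDForce_iff.2
    ⟨hu, hw, huw, fun v hwv huv => ?_⟩)
  by_contra hvw
  exact hwv.mem hw (hv v huv hvw)

end SimpleGraph

/-! ### The graph `graphH k`: a bit mask check that one path is entered late. -/

namespace HVertex

variable {k : ℕ}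

/-- The number of a vertex of `H_{2k+8}`, where each of the two paths gets one number only. -/
def idx : HVertex k → ℕ
  | x => 0
  | y => 1
  | x' => 2
  | y' => 3
  | z => 4
  | z' => 5
  | a _ => 6
  | b _ => 7

/-- The vertex of `H_8` with a given number, as a vertex of `H_{2k+8}`. -/
def rep (k : ℕ) : ℕ → HVertex k
  | 0 => x
  | 1 => y
  | 2 => x'
  | 3 => y'
  | 4 => z
  | 5 => z'
  | 6 => a 0
  | _ => b 0

/-- The neighborhoods in `H_8` as bit masks. -/
def nbrMask : ℕ → ℕ
  | 0 => 90
  | 1 => 157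
  | 2 => 170
  | 3 => 103
  | 4 => 35
  | 5 => 28
  | 6 => 9
  | _ => 6

/-- One round of breadth-first search in `H_8` from the set with mask `r`, among the vertices
outside the set with mask `m`. -/
def spreadMask (m r : ℕ) : ℕ :=
  [0, 1, 2, 3, 4, 5, 6, 7].foldl
    (fun acc j => bif acc.testBit j then acc ||| (nbrMask j &&& (255 ^^^ m)) else acc) r

/-- An approximation from above, in `H_8`, of the blue vertices one time step after the vertices
with mask `m` are blue. -/
def stepMask (m : ℕ) : ℕ :=
  [0, 1, 2, 3, 4, 5, 6, 7].foldl (fun acc w => bif !m.testBit w &&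
      [0, 1, 2, 3, 4, 5, 6, 7].any fun i => m.testBit i &&
        (nbrMask i &&& spreadMask m (spreadMask m (spreadMask m (1 <<< w)))) == 1 <<< w
    then acc ||| 1 <<< w else acc) m

/-- From the vertices with mask `m`, either some path of `H_8` is not entered within two time
steps, or the propagation stops before all vertices are blue. -/
def maskCheck (m : ℕ) : Bool :=
  !((stepMask (stepMask m)).testBit 6 && (stepMask (stepMask m)).testBit 7) ||
    (stepMask (stepMask^[6] m) == stepMask^[6] m &&
      !([0, 1, 2, 3, 4, 5, 6, 7].all fun i => (stepMask^[6] m).testBit i))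

-- Weakly sorted triples suffice: any set of at most three numbers below 8 is contained in one, and
-- masks only have to contain the blue vertices.
set_option maxRecDepth 10000 in
theorem maskCheck_triple : ∀ i < 8, ∀ j < 8, ∀ l < 8, i ≤ j → j ≤ l →
    maskCheck (1 <<< i ||| 1 <<< j ||| 1 <<< l) = true := by
  decide +kernel


theorem idx_lt (v : HVertex k) : idx v < 8 := by cases v <;> simp [idx]

theorem idx_rep : ∀ j < 8, idx (rep k j) = j := by
  intro j hj
  interval_cases j <;> rfl

theorem adj_rep_of_testBit (k : ℕ) {j : ℕ} (hj : j < 8) {i : ℕ}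
    (h : (nbrMask j).testBit i = true) : i < 8 ∧ (graphH k).Adj (rep k j) (rep k i) := by
  have hi : i < 8 := by
    by_contra hi
    have h1 : nbrMask j < 2 ^ 8 := by interval_cases j <;> decide
    have h2 := Nat.testBit_lt_two_pow
      (h1.trans_le (Nat.pow_le_pow_right (by norm_num) (not_lt.1 hi)))
    rw [h] at h2
    cases h2
  refine ⟨hi, ?_⟩
  interval_cases j <;> interval_cases i <;> first
    | (exfalso; revert h; decide)
    | simp [graphH, SimpleGraph.fromRel_adj, rep, edge]

/-- Edges leaving a path start at its first vertex, so a force between different numbers is visible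
in `H_8`. -/
theorem testBit_of_adj {u w : HVertex k} (h : (graphH k).Adj u w) (hne : idx u ≠ idx w) :
    (nbrMask (idx u)).testBit (idx w) = true ∧ u = rep k (idx u) ∧ w = rep k (idx w) := by
  cases u <;> cases w <;> simp [graphH, edge, idx] at h hne <;> subst_vars <;>
    refine ⟨?_, rfl, rfl⟩ <;> simp [idx, nbrMask, Nat.testBit]

theorem testBit_foldl (c : ℕ → Bool) (l : List ℕ) (m i : ℕ) :
    (l.foldl (fun acc w => bif c w then acc ||| 1 <<< w else acc) m).testBit i = true ↔
      m.testBit i = true ∨ (i ∈ l ∧ c i = true) := by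
  induction l generalizing m with
  | nil => simp
  | cons w l ih =>
    rw [List.foldl_cons, ih, List.mem_cons]
    by_cases hw : c w = true
    · rw [hw, cond_true, Nat.testBit_or, Nat.shiftLeft_eq, one_mul, Nat.testBit_two_pow]
      by_cases hiw : w = i
      · subst hiw
        simp [hw]
      · have : i ≠ w := fun h => hiw h.symm
        simp [hiw, this]
    · rw [Bool.not_eq_true] at hw
      rw [hw, cond_false]
      constructor
      · rintro (h | h)
        · exact Or.inl h
        · exact Or.inr ⟨Or.inr h.1, h.2⟩
      · rintro (h | ⟨rfl | h, h'⟩)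
        · exact Or.inl h
        · rw [hw] at h'
          cases h'
        · exact Or.inr ⟨h, h'⟩

theorem reachIn_spreadMask {X : Set (HVertex k)} {m : ℕ} (hX : ∀ v ∈ X, m.testBit (idx v) = true)
    {w : HVertex k} {r : ℕ}
    (hr : ∀ j, r.testBit j = true → j < 8 ∧ (graphH k).ReachIn Xᶜ w (rep k j)) :
    ∀ j, (spreadMask m r).testBit j = true → j < 8 ∧ (graphH k).ReachIn Xᶜ w (rep k j) := by
  unfold spreadMask
  generalize [0, 1, 2, 3, 4, 5, 6, 7] = l
  induction l generalizing r with
  | nil => exact hr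
  | cons j l ih =>
    rw [List.foldl_cons]
    refine ih ?_
    by_cases hj : r.testBit j = true
    · rw [hj, cond_true]
      intro i hi
      rw [Nat.testBit_or, Bool.or_eq_true, Nat.testBit_and, Bool.and_eq_true,
        Nat.testBit_xor] at hi
      rcases hi with hi | ⟨hi, him⟩
      · exact hr i hi
      obtain ⟨hj8, hreach⟩ := hr j hj
      obtain ⟨hi8, hadj⟩ := adj_rep_of_testBit k hj8 hi
      refine ⟨hi8, hreach.tail ⟨hadj, fun hiX => ?_⟩⟩
      have h1 := hX _ hiX
      rw [idx_rep i hi8] at h1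
      rw [h1] at him
      interval_cases i <;> revert him <;> decide
    · rw [Bool.not_eq_true] at hj
      rw [hj, cond_false]
      exact hr

/-- The mask contains the blue set, so three rounds of search reach only part of the true white
component; uniqueness of the white neighbor passes to this part. -/
theorem testBit_stepMask_of_force {X : Set (HVertex k)} {m : ℕ}
    (hX : ∀ v ∈ X, m.testBit (idx v) = true) {u w : HVertex k}
    (h : (graphH k).IsPSDForce X u w) : (stepMask m).testBit (idx w) = true := by
  obtain ⟨huX, hwX, huw, huniq⟩ := SimpleGraph.isPSDForce_iff.1 h
  unfold stepMask
  rw [testBit_foldl (fun w => !m.testBit w && [0, 1, 2, 3, 4, 5, 6, 7].any fun i =>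
    m.testBit i && (nbrMask i &&& spreadMask m (spreadMask m (spreadMask m (1 <<< w)))) == 1 <<< w)]
  by_cases hw : m.testBit (idx w) = true
  · exact Or.inl hw
  have hne : idx u ≠ idx w := fun h => hw (h ▸ hX u huX)
  obtain ⟨hbit, hu, hwr⟩ := testBit_of_adj huw hne
  have hlist : ∀ v : HVertex k, idx v ∈ [0, 1, 2, 3, 4, 5, 6, 7] := fun v => by
    cases v <;> simp [idx]
  refine Or.inr ⟨hlist w, ?_⟩
  rw [Bool.not_eq_true] at hw
  rw [hw, Bool.not_false, Bool.true_and, List.any_eq_true]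
  refine ⟨idx u, hlist u, ?_⟩
  rw [hX u huX, Bool.true_and, beq_iff_eq]
  have hbitw : ∀ j, (1 <<< idx w).testBit j = true ↔ j = idx w := fun j => by
    rw [Nat.shiftLeft_eq, one_mul, Nat.testBit_two_pow, decide_eq_true_iff, eq_comm]
  have h0 : ∀ j, (1 <<< idx w).testBit j = true →
      j < 8 ∧ (graphH k).ReachIn Xᶜ w (rep k j) := by
    intro j hj
    rw [hbitw] at hj
    subst hj
    exact ⟨idx_lt w, hwr ▸ .refl⟩
  have h3 := reachIn_spreadMask hX (reachIn_spreadMask hX (reachIn_spreadMask hX h0))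
  have hgrow : ∀ r, ∀ j, r.testBit j = true → (spreadMask m r).testBit j = true := by
    intro r j hr
    unfold spreadMask
    generalize [0, 1, 2, 3, 4, 5, 6, 7] = l
    induction l generalizing r with
    | nil => exact hr
    | cons i l ih =>
      rw [List.foldl_cons]
      refine ih _ ?_
      cases r.testBit i
      · exact hr
      · simp [hr]
  refine Nat.eq_of_testBit_eq fun j => ?_
  rw [Bool.eq_iff_iff, Nat.testBit_and, Bool.and_eq_true, hbitw]
  constructor
  · rintro ⟨h1, h2⟩
    obtain ⟨hj8, hreach⟩ := h3 j h2
    have hadj := (adj_rep_of_testBit k (idx_lt u) h1).2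
    rw [← hu] at hadj
    rw [← huniq _ hreach hadj, idx_rep j hj8]
  · rintro rfl
    exact ⟨hbit, hgrow _ _ (hgrow _ _ (hgrow _ _ ((hbitw _).2 rfl)))⟩

theorem testBit_iterate_stepMask {B : Set (HVertex k)} {m : ℕ}
    (hB : ∀ v ∈ B, m.testBit (idx v) = true) (t : ℕ) :
    ∀ v ∈ (graphH k).psdBlue B t, (stepMask^[t] m).testBit (idx v) = true := by
  induction t with
  | zero => exact hB
  | succ t ih =>
    rw [Function.iterate_succ_apply']
    rintro w (hw | ⟨u, hu⟩)
    · unfold stepMask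
      rw [testBit_foldl (fun w => !Nat.testBit _ w && List.any _ _)]
      exact Or.inl (ih w hw)
    · exact testBit_stepMask_of_force ih hu

theorem exists_sorted_triple {S : Finset ℕ} (hS : S.card ≤ 3) (h8 : ∀ i ∈ S, i < 8) :
    ∃ i < 8, ∃ j < 8, ∃ l < 8, i ≤ j ∧ j ≤ l ∧ ∀ s ∈ S, s = i ∨ s = j ∨ s = l := by
  obtain ⟨T, hST, hT, hTcard⟩ := Finset.exists_subsuperset_card_eq (s := S) (t := Finset.range 8)
    (n := 3) (fun i hi => Finset.mem_range.2 (h8 i hi)) hS (by simp)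
  have hmem := fun i : Fin 3 => Finset.orderEmbOfFin_mem T hTcard i
  have hmono := (T.orderEmbOfFin hTcard).monotone
  refine ⟨_, Finset.mem_range.1 (hT (hmem 0)), _, Finset.mem_range.1 (hT (hmem 1)), _,
    Finset.mem_range.1 (hT (hmem 2)), hmono (by decide), hmono (by decide), fun s hs => ?_⟩
  have : s ∈ Set.range (T.orderEmbOfFin hTcard) := by
    rw [Finset.range_orderEmbOfFin]
    exact hST hs
  obtain ⟨i, rfl⟩ := this
  fin_cases i <;> simp

/-- From three blue vertices, the two paths are not both entered within two time steps. -/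
theorem late_path {B : Finset (HVertex k)} (hB : B.card ≤ 3)
    (hforce : (graphH k).IsPSDForcingSet B) :
    (∀ i, a i ∉ (graphH k).psdBlue (B : Set (HVertex k)) 2) ∨
      ∀ i, b i ∉ (graphH k).psdBlue (B : Set (HVertex k)) 2 := by
  classical
  obtain ⟨i, hi, j, hj, l, hl, hij, hjl, hcover⟩ := exists_sorted_triple
    (S := B.image idx) (Finset.card_image_le.trans hB) (by
      intro s hs
      obtain ⟨v, -, rfl⟩ := Finset.mem_image.1 hs
      exact idx_lt v)
  have hcheck := maskCheck_triple i hi j hj l hl hij hjl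
  have hm : ∀ v ∈ (B : Set (HVertex k)),
      (1 <<< i ||| 1 <<< j ||| 1 <<< l).testBit (idx v) = true := by
    intro v hv
    simp only [Nat.testBit_or, Nat.shiftLeft_eq, one_mul, Nat.testBit_two_pow, Bool.or_eq_true,
      decide_eq_true_iff]
    rcases hcover (idx v) (Finset.mem_image_of_mem _ hv) with h | h | h <;> simp [h]
  generalize 1 <<< i ||| 1 <<< j ||| 1 <<< l = m at hcheck hm
  have hstep := testBit_iterate_stepMask hm
  rw [maskCheck, Bool.or_eq_true, Bool.not_eq_true', Bool.and_eq_false_iff, Bool.and_eq_true,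
    beq_iff_eq, Bool.not_eq_true', List.all_eq_false] at hcheck
  rcases hcheck with (h | h) | ⟨hfix, i, hi8, hbit⟩
  · left
    intro i hi
    have := hstep 2 _ hi
    rw [show stepMask^[2] m = stepMask (stepMask m) from rfl] at this
    exact absurd this (by simp [idx, h])
  · right
    intro i hi
    have := hstep 2 _ hi
    rw [show stepMask^[2] m = stepMask (stepMask m) from rfl] at this
    exact absurd this (by simp [idx, h])
  · obtain ⟨t, ht⟩ := hforce
    -- The mask is stationary from round 6 on and lacks a vertex, contrary to `B` being a forcing
    -- set.
    have hiter : ∀ t, stepMask^[t + 6] m = stepMask^[6] m := fun t => by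
      rw [Function.iterate_add_apply, Function.iterate_fixed hfix]
    have hi : i < 8 := by
      simp only [List.mem_cons, List.not_mem_nil, or_false] at hi8
      omega
    have hrep : rep k i ∈ (graphH k).psdBlue (B : Set (HVertex k)) (t + 6) :=
      SimpleGraph.psdBlue_mono_time (Nat.le_add_right t 6) (by rw [ht]; trivial)
    have := hstep _ _ hrep
    rw [hiter, idx_rep i hi] at this
    exact absurd this hbit

/-! ### Travelling along the paths: propagation time at least `k + 3`. -/

theorem adj_a (i : Fin (k + 1)) (v : HVertex k) : (graphH k).Adj (a i) v ↔
    ((i : ℕ) = 0 ∧ (v = x ∨ v = y')) ∨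
      ∃ j : Fin (k + 1), v = a j ∧ ((j : ℕ) = i + 1 ∨ (i : ℕ) = j + 1) := by
  cases v <;> simp [graphH, edge]
  intro h h'
  subst h'
  omega

theorem adj_b (i : Fin (k + 1)) (v : HVertex k) : (graphH k).Adj (b i) v ↔
    ((i : ℕ) = 0 ∧ (v = y ∨ v = x')) ∨
      ∃ j : Fin (k + 1), v = b j ∧ ((j : ℕ) = i + 1 ∨ (i : ℕ) = j + 1) := by
  cases v <;> simp [graphH, edge]
  intro h h'
  subst h'
  omega

/-- A path that is white at time 2 can be entered only at `p 0`, at time 3 or later, and then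
advances by at most one vertex per step. -/
theorem add_three_le_of_path {B : Set (HVertex k)} {p : Fin (k + 1) → HVertex k}
    (hp : ∀ (i : Fin (k + 1)) u, (i : ℕ) ≠ 0 → (graphH k).Adj u (p i) →
      ∃ j : Fin (k + 1), u = p j ∧ (i : ℕ) ≤ j + 1)
    (h2 : ∀ i, p i ∉ (graphH k).psdBlue B 2) (t : ℕ) :
    ∀ i, p i ∈ (graphH k).psdBlue B t → (i : ℕ) + 3 ≤ t := by
  induction t with
  | zero => exact fun i hi => absurd (SimpleGraph.psdBlue_mono_time (Nat.zero_le 2) hi) (h2 i)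
  | succ t ih =>
    rintro i (hi | ⟨u, hu⟩)
    · exact (ih i hi).trans (Nat.le_succ t)
    · obtain ⟨hut, -, hadj, -⟩ := SimpleGraph.isPSDForce_iff.1 hu
      by_cases hi0 : (i : ℕ) = 0
      · by_contra hlt
        exact h2 i (SimpleGraph.psdBlue_mono_time (show t + 1 ≤ 2 by omega) (Or.inr ⟨u, hu⟩))
      · obtain ⟨j, rfl, hj⟩ := hp i u hi0 hadj
        have := ih j hut
        omega

theorem add_three_le {B : Finset (HVertex k)} (hB : B.card ≤ 3) {t : ℕ}
    (ht : (graphH k).psdBlue (B : Set (HVertex k)) t = Set.univ) : k + 3 ≤ t := by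
  rcases late_path hB ⟨t, ht⟩ with h | h
  · refine add_three_le_of_path (p := a) ?_ h t (Fin.last k) (by rw [ht]; trivial)
    intro i u hi hadj
    rcases (adj_a _ _).1 hadj.symm with h | ⟨j, rfl, hj⟩
    · exact absurd h.1 hi
    · exact ⟨j, rfl, by omega⟩
  · refine add_three_le_of_path (p := b) ?_ h t (Fin.last k) (by rw [ht]; trivial)
    intro i u hi hadj
    rcases (adj_b _ _).1 hadj.symm with h | ⟨j, rfl, hj⟩
    · exact absurd h.1 hi
    · exact ⟨j, rfl, by omega⟩

theorem psdForcingNumber_graphH_le (k : ℕ) : (graphH k).psdForcingNumber ≤ 3 := by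
  -- Forces run from `a k` down to `a 0`, then `a 0 → y'`, `x → y`, `z → z'`, `y' → x'`, `x' → b 0`,
  -- and up the other path.
  have hB : (graphH k).IsPSDForcingSet {x, z, a (Fin.last k)} := by
    refine SimpleGraph.isPSDForcingSet_of_closed fun K hK hclosed => ?_
    have hx : x ∈ K := hK _ (by simp)
    have hz : z ∈ K := hK _ (by simp)
    have ha : ∀ d, ∀ i : Fin (k + 1), k ≤ i + d → a i ∈ K := by
      intro d
      induction d with
      | zero =>
        intro i hi
        rw [show i = Fin.last k from Fin.ext (by simp; omega)]
        exact hK _ (by simp)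
      | succ d ih =>
        intro i hi
        by_cases hi' : k ≤ i + d
        · exact ih i hi'
        refine hclosed (a ⟨i + 1, by omega⟩) (ih _ (by simp; omega)) (a i) ?_ ?_
        · rw [adj_a]
          exact Or.inr ⟨i, rfl, Or.inr rfl⟩
        · intro v hv hvi
          rcases (adj_a _ _).1 hv with ⟨h, -⟩ | ⟨j, rfl, h⟩
          · exact absurd h (Nat.succ_ne_zero _)
          · refine ih j ?_
            have : (j : ℕ) ≠ i := fun h => hvi (by rw [Fin.ext h])
            simp only at h
            omega
    have ha' : ∀ i, a i ∈ K := fun i => ha k i (by omega)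
    have hy' : y' ∈ K := by
      refine hclosed (a 0) (ha' 0) _ (by simp [graphH, edge]) fun v hv hvi => ?_
      cases v <;> simp [graphH, edge] at hv hvi <;> first | assumption | exact ha' _
    have hy : y ∈ K := by
      refine hclosed x hx _ (by simp [graphH, edge]) fun v hv hvi => ?_
      cases v <;> simp [graphH, edge] at hv hvi <;> first | assumption | exact ha' _
    have hz' : z' ∈ K := by
      refine hclosed z hz _ (by simp [graphH, edge]) fun v hv hvi => ?_
      cases v <;> simp [graphH, edge] at hv hvi <;> assumption
    have hx' : x' ∈ K := by
      refine hclosed y' hy' _ (by simp [graphH, edge]) fun v hv hvi => ?_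
      cases v <;> simp [graphH, edge] at hv hvi <;> first | assumption | exact ha' _
    have hb : ∀ d, ∀ i : Fin (k + 1), (i : ℕ) ≤ d → b i ∈ K := by
      intro d
      induction d with
      | zero =>
        intro i hi
        rw [show i = 0 from Fin.ext (by simpa using hi)]
        refine hclosed x' hx' _ (by simp [graphH, edge]) fun v hv hvi => ?_
        cases v <;> simp [graphH, edge] at hv hvi <;> first | assumption | exact absurd hv hvi
      | succ d ih =>
        intro i hi
        by_cases hi' : (i : ℕ) ≤ d
        · exact ih i hi'
        refine hclosed (b ⟨d, by omega⟩) (ih _ le_rfl) (b i) ?_ ?_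
        · rw [adj_b]
          exact Or.inr ⟨i, rfl, Or.inl (by simp only; omega)⟩
        · intro v hv hvi
          rcases (adj_b _ _).1 hv with ⟨h, rfl | rfl⟩ | ⟨j, rfl, h⟩
          · exact hy
          · exact hx'
          · refine ih j ?_
            have : (j : ℕ) ≠ i := fun h => hvi (by rw [Fin.ext h])
            simp only at h
            omega
    intro v
    cases v <;> first | assumption | exact ha' _ | exact hb k _ (by omega)
  exact hB.psdForcingNumber_le.trans Finset.card_le_three

theorem le_psdPropTime_graphH (k : ℕ) : ((k + 3 : ℕ) : ℕ∞) ≤ (graphH k).psdPropTime :=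
  SimpleGraph.le_psdPropTime fun _ _ hB ht =>
    add_three_le (hB.le.trans (psdForcingNumber_graphH_le k)) ht

end HVertex

/-! ### The complement of `graphH k`: five white vertices need three steps. -/

namespace SimpleGraph

variable {V : Type*} {G : SimpleGraph V}

/-- A force in the complement, expressed in terms of the graph. -/
theorem IsPSDForce.adj_of_compl {X D : Set V} {u w : V} (h : Gᶜ.IsPSDForce X u w)
    (hD : Gᶜ.ConnectedOn D) (hDX : D ⊆ Xᶜ) (hw : w ∈ D) :
    u ∈ X ∧ ¬ G.Adj u w ∧ ∀ v ∈ D, v ≠ w → G.Adj u v := by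
  obtain ⟨hu, -, huw, huniq⟩ := isPSDForce_iff.1 h
  refine ⟨hu, ((compl_adj _ _ _).1 huw).2, fun v hv hvw => ?_⟩
  by_contra hadj
  refine hvw (huniq v ((hD w hw v hv).mono hDX) ((compl_adj _ _ _).2 ⟨?_, hadj⟩))
  rintro rfl
  exact hDX hv hu

/-- If `D` is disconnected in the complement, one component and the rest of `D` are completely
joined in `G`. -/
theorem connectedOn_compl_or_join (G : SimpleGraph V) (D : Finset V) :
    Gᶜ.ConnectedOn (D : Set V) ∨ ∃ P Q : Finset V, P.Nonempty ∧ Q.Nonempty ∧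
      P ⊆ D ∧ Q ⊆ D ∧ P.card + Q.card = D.card ∧ ∀ p ∈ P, ∀ q ∈ Q, G.Adj p q := by
  classical
  by_cases h : Gᶜ.ConnectedOn (D : Set V)
  · exact Or.inl h
  right
  unfold ConnectedOn at h
  push Not at h
  obtain ⟨a, ha, b, hb, hab⟩ := h
  refine ⟨D.filter fun x => Gᶜ.ReachIn (D : Set V) a x,
    D.filter fun x => ¬ Gᶜ.ReachIn (D : Set V) a x, ⟨a, ?_⟩, ⟨b, ?_⟩, Finset.filter_subset _ _,
    Finset.filter_subset _ _, Finset.card_filter_add_card_filter_not _, fun p hp q hq => ?_⟩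
  · exact Finset.mem_filter.2 ⟨ha, .refl⟩
  · exact Finset.mem_filter.2 ⟨hb, hab⟩
  · rw [Finset.mem_filter] at hp hq
    by_contra hadj
    refine hq.2 (Relation.ReflTransGen.tail hp.2 ⟨(compl_adj _ _ _).2 ⟨?_, hadj⟩, hq.1⟩)
    rintro rfl
    exact hq.2 hp.2

end SimpleGraph

namespace HVertex

variable {k : ℕ}

theorem adj_x (v : HVertex k) :
    (graphH k).Adj x v ↔ v ∈ ({y, y', z, a 0} : Finset (HVertex k)) := by
  cases v <;> simp [graphH, edge]

theorem adj_y (v : HVertex k) :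
    (graphH k).Adj y v ↔ v ∈ ({x, x', y', z, b 0} : Finset (HVertex k)) := by
  cases v <;> simp [graphH, edge]

theorem adj_x' (v : HVertex k) :
    (graphH k).Adj x' v ↔ v ∈ ({y, y', z', b 0} : Finset (HVertex k)) := by
  cases v <;> simp [graphH, edge]

theorem adj_y' (v : HVertex k) :
    (graphH k).Adj y' v ↔ v ∈ ({x, x', y, z', a 0} : Finset (HVertex k)) := by
  cases v <;> simp [graphH, edge]

theorem adj_z (v : HVertex k) :
    (graphH k).Adj z v ↔ v ∈ ({x, y, z'} : Finset (HVertex k)) := by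
  cases v <;> simp [graphH, edge]

theorem adj_z' (v : HVertex k) :
    (graphH k).Adj z' v ↔ v ∈ ({x', y', z} : Finset (HVertex k)) := by
  cases v <;> simp [graphH, edge]

/-- The pairs of vertices with three common neighbors. -/
def Special (u v : HVertex k) (S : Finset (HVertex k)) : Prop :=
  (u = y ∧ v = z' ∧ S = {z, x', y'}) ∨ (u = z' ∧ v = y ∧ S = {z, x', y'}) ∨
    (u = y' ∧ v = z ∧ S = {z', x, y}) ∨ (u = z ∧ v = y' ∧ S = {z', x, y})

theorem card_le_two_of_adj_path {p : Fin (k + 1) → HVertex k} (hinj : Function.Injective p)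
    {c₁ c₂ : HVertex k} (hc₁ : ∀ j, c₁ ≠ p j) (hc₂ : ∀ j, c₂ ≠ p j)
    (hp : ∀ i v, (graphH k).Adj (p i) v ↔ ((i : ℕ) = 0 ∧ (v = c₁ ∨ v = c₂)) ∨
      ∃ j : Fin (k + 1), v = p j ∧ ((j : ℕ) = i + 1 ∨ (i : ℕ) = j + 1))
    {i : Fin (k + 1)} {v : HVertex k} (hne : p i ≠ v)
    {S : Finset (HVertex k)} (h : ∀ c ∈ S, (graphH k).Adj (p i) c ∧ (graphH k).Adj v c) :
    S.card ≤ 2 := by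
  have hsub : ∃ d e, ∀ c ∈ S, c = d ∨ c = e := by
    by_cases hv : ∃ j, v = p j
    · obtain ⟨j, rfl⟩ := hv
      have hij : (i : ℕ) ≠ j := fun h => hne (by rw [Fin.ext h])
      rcases S.eq_empty_or_nonempty with rfl | ⟨d, hd⟩
      · exact ⟨c₁, c₁, by simp⟩
      have key : ∀ c ∈ S, ∃ l : Fin (k + 1), c = p l ∧ ((l : ℕ) = i + 1 ∨ (i : ℕ) = l + 1) ∧
          ((l : ℕ) = j + 1 ∨ (j : ℕ) = l + 1) := by
        intro c hc
        obtain ⟨h1, h2⟩ := h c hc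
        rcases (hp _ _).1 h1 with ⟨hi, h1⟩ | ⟨l, rfl, hl⟩ <;>
          rcases (hp _ _).1 h2 with ⟨hj, h2⟩ | ⟨l', h', hl'⟩
        · omega
        · subst h'
          rcases h1 with h1 | h1
          · exact absurd h1.symm (hc₁ l')
          · exact absurd h1.symm (hc₂ l')
        · rcases h2 with h2 | h2
          · exact absurd h2.symm (hc₁ l)
          · exact absurd h2.symm (hc₂ l)
        · obtain rfl : l = l' := hinj h'
          exact ⟨l, rfl, hl, hl'⟩
      refine ⟨d, d, fun c hc => Or.inl ?_⟩
      obtain ⟨l, rfl, hl⟩ := key c hc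
      obtain ⟨l', rfl, hl'⟩ := key d hd
      congr 1
      ext
      omega
    · have hv0 : ∀ l, (graphH k).Adj v (p l) → (l : ℕ) = 0 := fun l hl => by
        rcases (hp _ _).1 hl.symm with h | ⟨j, rfl, -⟩
        · exact h.1
        · exact absurd ⟨j, rfl⟩ hv
      by_cases hi : (i : ℕ) = 0
      · refine ⟨c₁, c₂, fun c hc => ?_⟩
        obtain ⟨h1, h2⟩ := h c hc
        rcases (hp _ _).1 h1 with h1 | ⟨l, rfl, hl⟩
        · exact h1.2
        · have := hv0 l h2
          omega
      · refine ⟨p 0, p 0, fun c hc => ?_⟩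
        obtain ⟨h1, h2⟩ := h c hc
        rcases (hp _ _).1 h1 with h1 | ⟨l, rfl, hl⟩
        · exact absurd h1.1 hi
        · have : l = 0 := Fin.ext (hv0 l h2)
          simp [this]
  obtain ⟨d, e, hde⟩ := hsub
  exact (Finset.card_le_card fun c hc => by simpa using hde c hc).trans
    (Finset.card_le_two (a := d) (b := e))

theorem card_le_two_of_adj_a {i : Fin (k + 1)} {v : HVertex k} (hne : a i ≠ v)
    {S : Finset (HVertex k)} (h : ∀ c ∈ S, (graphH k).Adj (a i) c ∧ (graphH k).Adj v c) :
    S.card ≤ 2 :=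
  card_le_two_of_adj_path (p := a) (fun _ _ h => by simpa using h) (by simp) (by simp) adj_a hne h

theorem card_le_two_of_adj_b {i : Fin (k + 1)} {v : HVertex k} (hne : b i ≠ v)
    {S : Finset (HVertex k)} (h : ∀ c ∈ S, (graphH k).Adj (b i) c ∧ (graphH k).Adj v c) :
    S.card ≤ 2 :=
  card_le_two_of_adj_path (p := b) (fun _ _ h => by simpa using h) (by simp) (by simp) adj_b hne h

/-- Pairs meeting a path have at most two common neighbors. For the other pairs, either two named
vertices cover all common neighbors (`hsmall`) or the pair is one of the listed ones (`hthree`). -/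
theorem special_of_common_neighbors {u v : HVertex k} (hne : u ≠ v) {S : Finset (HVertex k)}
    (hS : 3 ≤ S.card) (h : ∀ c ∈ S, (graphH k).Adj u c ∧ (graphH k).Adj v c) :
    Special u v S := by
  have hsmall : ∀ p q : HVertex k, (∀ c ∈ S, c = p ∨ c = q) → Special u v S := fun p q hpq => by
    have := (Finset.card_le_card fun c hc => by simpa using hpq c hc).trans
      (Finset.card_le_two (a := p) (b := q))
    omega
  have hthree : ∀ p q r : HVertex k, (∀ c ∈ S, c = p ∨ c = q ∨ c = r) → S = {p, q, r} :=
    fun p q r hpqr => Finset.eq_of_subset_of_card_le (fun c hc => by simpa using hpqr c hc)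
      (Finset.card_le_three.trans hS)
  cases u
  case a i => exact absurd (card_le_two_of_adj_a hne h) (by omega)
  case b i => exact absurd (card_le_two_of_adj_b hne h) (by omega)
  all_goals
    cases v
    case a i => exact absurd (card_le_two_of_adj_a hne.symm fun c hc => (h c hc).symm) (by omega)
    case b i => exact absurd (card_le_two_of_adj_b hne.symm fun c hc => (h c hc).symm) (by omega)
    all_goals
      simp only [adj_x, adj_y, adj_x', adj_y', adj_z, adj_z', Finset.mem_insert,
        Finset.mem_singleton] at h
      first
      | exact absurd rfl hne
      | exact hsmall x y (by grind)
      | exact hsmall x x' (by grind)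
      | exact hsmall x y' (by grind)
      | exact hsmall x z' (by grind)
      | exact hsmall y x' (by grind)
      | exact hsmall y y' (by grind)
      | exact hsmall y z (by grind)
      | exact hsmall y (a 0) (by grind)
      | exact hsmall z y' (by grind)
      | exact hsmall y z' (by grind)
      | exact hsmall x' y' (by grind)
      | exact hsmall x' z (by grind)
      | exact hsmall y' z' (by grind)
      | exact hsmall y' (a 0) (by grind)
      | exact hsmall x (a 0) (by grind)
      | exact hsmall x' (b 0) (by grind)
      | exact hsmall y' (b 0) (by grind)
      | (have hS' := hthree z x' y' (by grind)
         simp [Special, hS'])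
      | (have hS' := hthree z' x y (by grind)
         simp [Special, hS'])

theorem Special.not_adj {u v : HVertex k} {S : Finset (HVertex k)} (h : Special u v S) :
    ¬ (graphH k).Adj u v := by
  rcases h with ⟨rfl, rfl, -⟩ | ⟨rfl, rfl, -⟩ | ⟨rfl, rfl, -⟩ | ⟨rfl, rfl, -⟩ <;>
    simp [graphH, edge]

theorem Special.eq {u v v' : HVertex k} {S S' : Finset (HVertex k)} (h : Special u v S)
    (h' : Special u v' S') : S = S' := by
  rcases h with ⟨rfl, -, rfl⟩ | ⟨rfl, -, rfl⟩ | ⟨rfl, -, rfl⟩ | ⟨rfl, -, rfl⟩ <;>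
    simp [Special] at h' <;> exact h'.2.symm

theorem Special.cases {u v : HVertex k} {S : Finset (HVertex k)} (h : Special u v S) :
    (S = {z, x', y'} ∧ (u = z' ∨ v = z')) ∨ (S = {z', x, y} ∧ (u = z ∨ v = z)) := by
  rcases h with ⟨rfl, rfl, rfl⟩ | ⟨rfl, rfl, rfl⟩ | ⟨rfl, rfl, rfl⟩ | ⟨rfl, rfl, rfl⟩ <;>
    simp

/-- Of a pair of vertices with three common neighbors, one has degree three. -/
theorem Special.card_le_three {u v : HVertex k} {S : Finset (HVertex k)} (h : Special u v S)
    {T : Finset (HVertex k)} (hT : ∀ c ∈ T, (graphH k).Adj u c)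
    {U : Finset (HVertex k)} (hU : ∀ c ∈ U, (graphH k).Adj v c) : T.card ≤ 3 ∨ U.card ≤ 3 := by
  have hz : ∀ A : Finset (HVertex k), (∀ c ∈ A, (graphH k).Adj z c) → A.card ≤ 3 := fun A hA =>
    (Finset.card_le_card fun c hc => (adj_z c).1 (hA c hc)).trans Finset.card_le_three
  have hz' : ∀ A : Finset (HVertex k), (∀ c ∈ A, (graphH k).Adj z' c) → A.card ≤ 3 := fun A hA =>
    (Finset.card_le_card fun c hc => (adj_z' c).1 (hA c hc)).trans Finset.card_le_three
  rcases h.cases with ⟨-, rfl | rfl⟩ | ⟨-, rfl | rfl⟩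
  · exact Or.inl (hz' T hT)
  · exact Or.inr (hz' U hU)
  · exact Or.inl (hz T hT)
  · exact Or.inr (hz U hU)

/-- Four neighbors of a vertex induce a connected subgraph of the complement. -/
theorem connectedOn_compl_of_adj {u : HVertex k} {T : Finset (HVertex k)} (hT : T.card = 4)
    (hu : ∀ c ∈ T, (graphH k).Adj u c) : (graphH k)ᶜ.ConnectedOn (T : Set (HVertex k)) := by
  refine (SimpleGraph.connectedOn_compl_or_join (graphH k) T).resolve_right ?_
  have hone : ∀ P Q : Finset (HVertex k), P.card = 1 → Q.card = 3 → P ⊆ T → Q ⊆ T →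
      (∀ p ∈ P, ∀ q ∈ Q, (graphH k).Adj p q) → False := by
    intro P Q hP hQ hPT hQT hPQ
    obtain ⟨p, rfl⟩ := Finset.card_eq_one.1 hP
    have hup := hu p (hPT (Finset.mem_singleton_self p))
    exact (special_of_common_neighbors hup.ne hQ.ge fun c hc =>
      ⟨hu c (hQT hc), hPQ p (Finset.mem_singleton_self p) c hc⟩).not_adj hup
  rintro ⟨P, Q, hP, hQ, hPT, hQT, hcard, hPQ⟩
  have hP' := hP.card_pos
  have hQ' := hQ.card_pos
  obtain h | h | h : P.card = 1 ∨ P.card = 2 ∨ P.card = 3 := by omega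
  · exact hone P Q h (by omega) hPT hQT hPQ
  -- In a 2 + 2 join each side is a special pair with `u` among its common neighbors. Different
  -- special pairs have disjoint sets of common neighbors, so this is impossible.
  · have htwo : ∀ P Q : Finset (HVertex k), P.card = 2 → Q.card = 2 → P ⊆ T → Q ⊆ T →
        (∀ p ∈ P, ∀ q ∈ Q, (graphH k).Adj p q) →
        ∃ p q, P = {p, q} ∧ Special p q (insert u Q) := by
      intro P Q hP hQ hPT hQT hPQ
      obtain ⟨p, q, hpq, rfl⟩ := Finset.card_eq_two.1 hP
      have huQ : u ∉ Q := fun h => (hu u (hQT h)).ne rfl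
      refine ⟨p, q, rfl, special_of_common_neighbors hpq ?_ fun c hc => ?_⟩
      · rw [Finset.card_insert_of_notMem huQ]
        omega
      · rcases Finset.mem_insert.1 hc with rfl | hc
        · exact ⟨(hu p (hPT (by simp))).symm, (hu q (hPT (by simp))).symm⟩
        · exact ⟨hPQ p (by simp) c hc, hPQ q (by simp) c hc⟩
    obtain ⟨p, q, rfl, hpq⟩ := htwo P Q h (by omega) hPT hQT hPQ
    obtain ⟨r, s, rfl, hrs⟩ := htwo Q {p, q} (by omega) h hQT hPT
      fun a ha b hb => (hPQ b hb a ha).symm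
    have h1 : u ∈ insert u ({r, s} : Finset (HVertex k)) := by simp
    have h2 : u ∈ insert u ({p, q} : Finset (HVertex k)) := by simp
    have h3 : r ∈ insert u ({r, s} : Finset (HVertex k)) := by simp
    rcases hpq with ⟨rfl, rfl, e⟩ | ⟨rfl, rfl, e⟩ | ⟨rfl, rfl, e⟩ | ⟨rfl, rfl, e⟩ <;>
      rcases hrs with ⟨rfl, rfl, e'⟩ | ⟨rfl, rfl, e'⟩ | ⟨rfl, rfl, e'⟩ | ⟨rfl, rfl, e'⟩ <;>
      rw [e] at h1 h3 <;> rw [e'] at h2 <;> simp at h1 h2 h3 <;>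
      rcases h1 with rfl | rfl | rfl <;> simp at h2
  · exact hone Q P (by omega) h hQT hPT fun a ha b hb => (hPQ b hb a ha).symm

/-- Among four white neighbors of a vertex, at most one can be forced in the complement. -/
theorem eq_of_force_of_force {u : HVertex k} {T : Finset (HVertex k)} (hT : T.card = 4)
    (hu : ∀ c ∈ T, (graphH k).Adj u c) {X : Set (HVertex k)} (hTX : ∀ c ∈ T, c ∉ X)
    {f g : HVertex k} (hf : f ∈ T) (hg : g ∈ T) {p q : HVertex k}
    (hpf : (graphH k)ᶜ.IsPSDForce X p f) (hqg : (graphH k)ᶜ.IsPSDForce X q g) : f = g := by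
  have key : ∀ f ∈ T, ∀ p, (graphH k)ᶜ.IsPSDForce X p f → Special u p (T.erase f) := by
    intro f hf p hpf
    obtain ⟨-, hnadj, hadj⟩ := hpf.adj_of_compl (connectedOn_compl_of_adj hT hu) hTX hf
    refine special_of_common_neighbors ?_ ?_ fun c hc => ?_
    · rintro rfl
      exact hnadj (hu f hf)
    · rw [Finset.card_erase_of_mem hf, hT]
    · obtain ⟨hcf, hc⟩ := Finset.mem_erase.1 hc
      exact ⟨hu c hc, hadj c hc hcf⟩
  -- The set `T.erase f` is determined by `u` alone, hence so is `f`.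
  have heq := (key f hf p hpf).eq (key g hg q hqg)
  by_contra hfg
  have : f ∈ T.erase f := by
    rw [heq]
    exact Finset.mem_erase.2 ⟨hfg, hf⟩
  simp at this

theorem connectedOn_compl_pair {p q : HVertex k} (h : ¬ (graphH k).Adj p q) :
    (graphH k)ᶜ.ConnectedOn ({p, q} : Set (HVertex k)) := by
  have key : ∀ a b, a ∈ ({p, q} : Set (HVertex k)) → b ∈ ({p, q} : Set (HVertex k)) →
      a ≠ b → (graphH k)ᶜ.Adj a b := by
    intro a b ha hb hab
    rw [SimpleGraph.compl_adj]
    rcases ha with rfl | rfl <;> rcases hb with rfl | rfl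
    · exact absurd rfl hab
    · exact ⟨hab, h⟩
    · exact ⟨hab, fun h' => h h'.symm⟩
    · exact absurd rfl hab
  intro a ha b hb
  by_cases hab : a = b
  · subst hab
    exact .refl
  · exact Relation.ReflTransGen.single ⟨key a b ha hb hab, hb⟩

/-- `z` and `y'` lie in one white component of the complement, so a forcing vertex would be a
neighbor of `z` but not of `y'`; every neighbor of `z` is adjacent to `y'`. -/
theorem not_force_y' {X : Set (HVertex k)} (hz : z ∉ X) (hy' : y' ∉ X) {u : HVertex k} :
    ¬ (graphH k)ᶜ.IsPSDForce X u y' := by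
  intro h
  obtain ⟨-, hnadj, hadj⟩ := h.adj_of_compl (D := {z, y'})
    (connectedOn_compl_pair (by simp [graphH, edge])) (by rintro v (rfl | rfl) <;> assumption)
    (by simp)
  have := (adj_z u).1 (hadj z (by simp) (by simp)).symm
  simp only [Finset.mem_insert, Finset.mem_singleton] at this
  rcases this with rfl | rfl | rfl <;> exact hnadj (by simp [graphH, edge])

theorem not_force_y {X : Set (HVertex k)} (hz' : z' ∉ X) (hy : y ∉ X) {u : HVertex k} :
    ¬ (graphH k)ᶜ.IsPSDForce X u y := by
  intro h
  obtain ⟨-, hnadj, hadj⟩ := h.adj_of_compl (D := {z', y})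
    (connectedOn_compl_pair (by simp [graphH, edge])) (by rintro v (rfl | rfl) <;> assumption)
    (by simp)
  have := (adj_z' u).1 (hadj z' (by simp) (by simp)).symm
  simp only [Finset.mem_insert, Finset.mem_singleton] at this
  rcases this with rfl | rfl | rfl <;> exact hnadj (by simp [graphH, edge])

/-- If three common neighbors of two vertices are white, then it takes more than one time step
to force them in the complement. -/
theorem Special.exists_not_force {p q : HVertex k} {S : Finset (HVertex k)} (h : Special p q S)
    {X : Set (HVertex k)} (hX : ∀ c ∈ S, c ∉ X) :
    ∃ c ∈ S, ∀ u, ¬ (graphH k)ᶜ.IsPSDForce X u c := by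
  rcases h.cases with ⟨rfl, -⟩ | ⟨rfl, -⟩
  · exact ⟨y', by simp, fun u => not_force_y' (hX _ (by simp)) (hX _ (by simp))⟩
  · exact ⟨y, by simp, fun u => not_force_y (hX _ (by simp)) (hX _ (by simp))⟩

theorem connectedOn_compl_path {p q r : HVertex k} (h : ¬ (graphH k).Adj p q)
    (h' : ¬ (graphH k).Adj p r) : (graphH k)ᶜ.ConnectedOn ({p, q, r} : Set (HVertex k)) := by
  have h1 := (connectedOn_compl_pair h)
  have h2 := (connectedOn_compl_pair h')
  have hp : ∀ a ∈ ({p, q, r} : Set (HVertex k)), (graphH k)ᶜ.ReachIn {p, q, r} p a := by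
    rintro a (rfl | rfl | rfl)
    · exact .refl
    · exact (h1 p (by simp) a (by simp)).mono (by intro c; simp; tauto)
    · exact (h2 p (by simp) a (by simp)).mono (by intro c; simp; tauto)
  exact fun a ha b hb => ((hp a ha).symm (by simp)).trans (hp b hb)

/-- If three common neighbors of two vertices are white, then it takes more than two time steps
to force them in the complement. -/
theorem Special.exists_late {p q : HVertex k} {S : Finset (HVertex k)} (h : Special p q S)
    {X : Set (HVertex k)} (hX : ∀ c ∈ S, c ∉ X) : ∃ c ∈ S, c ∉ (graphH k)ᶜ.psdBlue X 2 := by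
  -- While `c` is white, `e` cannot be forced, and `c` is not forced in the first step because every
  -- common neighbor of `d` and `e` is adjacent to `c`.
  have main : ∀ c d e : HVertex k, (∀ v ∈ ({c, d, e} : Finset (HVertex k)), v ∉ X) →
      d ≠ c → e ≠ c → ¬ (graphH k).Adj c d → ¬ (graphH k).Adj c e →
      (∀ u, (graphH k).Adj u d → (graphH k).Adj u e → (graphH k).Adj u c) →
      (∀ (Y : Set (HVertex k)) u, c ∉ Y → e ∉ Y → ¬ (graphH k)ᶜ.IsPSDForce Y u e) →
      e ∉ (graphH k)ᶜ.psdBlue X 2 := by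
    intro c d e hX hdc hec hcd hce hcommon hforce
    have he : e ∉ (graphH k)ᶜ.psdBlue X 1 := by
      rintro (h | ⟨u, hu⟩)
      · exact hX e (by simp) h
      · exact hforce _ u (hX c (by simp)) (hX e (by simp)) hu
    have hc : c ∉ (graphH k)ᶜ.psdBlue X 1 := by
      rintro (h | ⟨u, hu⟩)
      · exact hX c (by simp) h
      · obtain ⟨-, hnadj, hadj⟩ := hu.adj_of_compl (D := {c, d, e})
          (connectedOn_compl_path hcd hce) (fun v hv => hX v (by simpa using hv)) (by simp)
        exact hnadj (hcommon u (hadj d (by simp) hdc) (hadj e (by simp) hec))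
    rintro (h | ⟨u, hu⟩)
    · exact he h
    · exact hforce _ u hc he hu
  rcases h.cases with ⟨rfl, -⟩ | ⟨rfl, -⟩
  · refine ⟨y', by simp, main z x' y' hX (by simp) (by simp) (by simp [graphH, edge])
      (by simp [graphH, edge]) (fun u h1 h2 => ?_) fun Y u h1 h2 => not_force_y' h1 h2⟩
    rw [SimpleGraph.adj_comm, adj_x'] at h1
    rw [SimpleGraph.adj_comm, adj_y'] at h2
    rw [SimpleGraph.adj_comm, adj_z]
    grind
  · refine ⟨y, by simp, main z' x y hX (by simp) (by simp) (by simp [graphH, edge])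
      (by simp [graphH, edge]) (fun u h1 h2 => ?_) fun Y u h1 h2 => not_force_y h1 h2⟩
    rw [SimpleGraph.adj_comm, adj_x] at h1
    rw [SimpleGraph.adj_comm, adj_y] at h2
    rw [SimpleGraph.adj_comm, adj_z']
    grind

/-- Five white vertices are not forced within two time steps in the complement. -/
theorem psdBlue_two_ne_univ {X : Set (HVertex k)} {W : Finset (HVertex k)} (hW : W.card = 5)
    (hWX : ∀ v, v ∈ X ↔ v ∉ W) : (graphH k)ᶜ.psdBlue X 2 ≠ Set.univ := by
  intro h2
  have hWX' : ∀ c ∈ W, c ∉ X := fun c hc h => (hWX c).1 h hc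
  have hforce1 : ∀ c ∈ W, c ∈ (graphH k)ᶜ.psdBlue X 1 →
      ∃ u, (graphH k)ᶜ.IsPSDForce X u c := by
    rintro c hc (h | h)
    · exact absurd h (hWX' c hc)
    · exact h
  have hforce2 : ∀ c, c ∉ (graphH k)ᶜ.psdBlue X 1 →
      ∃ u, (graphH k)ᶜ.IsPSDForce ((graphH k)ᶜ.psdBlue X 1) u c := by
    intro c hc
    have : c ∈ (graphH k)ᶜ.psdBlue X 2 := by rw [h2]; trivial
    exact this.resolve_left hc
  -- Four neighbors of one vertex cannot all be left for the second step, which forces at most one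
  -- of them.
  have htwo : ∀ (u : HVertex k) (T : Finset (HVertex k)), T.card = 4 →
      (∀ c ∈ T, (graphH k).Adj u c) → ¬ ∀ c ∈ T, c ∉ (graphH k)ᶜ.psdBlue X 1 := by
    intro u T hT hu hTX
    obtain ⟨f, hf, g, hg, hfg⟩ := Finset.one_lt_card.1 (by omega : 1 < T.card)
    obtain ⟨p, hp⟩ := hforce2 f (hTX f hf)
    obtain ⟨q, hq⟩ := hforce2 g (hTX g hg)
    exact hfg (eq_of_force_of_force hT hu hTX hf hg hp hq)
  rcases SimpleGraph.connectedOn_compl_or_join (graphH k) W with hconn |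
    ⟨P, Q, hP, hQ, hPW, hQW, hcard, hPQ⟩
  -- If `W` is connected in the complement, two vertices of `W` must be forced in step 1. Their
  -- forcing vertices have four neighbors each and share three, but a special pair contains a vertex
  -- of degree three.
  · have hex : ∃ w ∈ W, w ∈ (graphH k)ᶜ.psdBlue X 1 := by
      by_contra hno
      push Not at hno
      have heq : (graphH k)ᶜ.psdBlue X 1 = X := by
        refine subset_antisymm (fun v hv => ?_) (SimpleGraph.subset_psdBlue X 1)
        rw [hWX]
        exact fun hvW => hno v hvW hv
      obtain ⟨w, hw⟩ := Finset.card_pos.1 (by omega : 0 < W.card)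
      obtain ⟨u, hu⟩ := hforce2 w (hno w hw)
      rw [heq] at hu
      exact hno w hw (Or.inr ⟨u, hu⟩)
    obtain ⟨w, hw, hw1⟩ := hex
    obtain ⟨u, hu⟩ := hforce1 w hw hw1
    obtain ⟨-, -, hadj⟩ := hu.adj_of_compl hconn hWX' hw
    have hT : ∀ c ∈ W.erase w, (graphH k).Adj u c := fun c hc =>
      hadj c (Finset.mem_of_mem_erase hc) (Finset.ne_of_mem_erase hc)
    refine htwo u _ (by rw [Finset.card_erase_of_mem hw, hW]) hT fun f hf hf1 => ?_
    have hfW := Finset.mem_of_mem_erase hf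
    obtain ⟨p, hp⟩ := hforce1 f hfW hf1
    obtain ⟨-, hnadj, hadj'⟩ := hp.adj_of_compl hconn hWX' hfW
    have hT' : ∀ c ∈ W.erase f, (graphH k).Adj p c := fun c hc =>
      hadj' c (Finset.mem_of_mem_erase hc) (Finset.ne_of_mem_erase hc)
    have hne : u ≠ p := by
      rintro rfl
      exact hnadj (hT f hf)
    have hS : Special u p ((W.erase w).erase f) := by
      refine special_of_common_neighbors hne ?_ fun c hc => ?_
      · rw [Finset.card_erase_of_mem hf, Finset.card_erase_of_mem hw, hW]
      · obtain ⟨hcf, hc⟩ := Finset.mem_erase.1 hc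
        exact ⟨hT c hc, hT' c (Finset.mem_erase.2 ⟨hcf, Finset.mem_of_mem_erase hc⟩)⟩
    have := hS.card_le_three hT hT'
    rw [Finset.card_erase_of_mem hw, Finset.card_erase_of_mem hfW, hW] at this
    omega
  -- In a 1 + 4 join exactly one vertex of `Q` is forced in step 1. The other three are common
  -- neighbors of a special pair and cannot all be forced in step 2.
  have hone : ∀ P Q : Finset (HVertex k), P.card = 1 → Q.card = 4 → P ⊆ W → Q ⊆ W →
      (∀ p ∈ P, ∀ q ∈ Q, (graphH k).Adj p q) → False := by
    intro P Q hP hQ hPW hQW hPQ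
    obtain ⟨v, rfl⟩ := Finset.card_eq_one.1 hP
    have hv : ∀ c ∈ Q, (graphH k).Adj v c := hPQ v (Finset.mem_singleton_self v)
    refine htwo v Q hQ hv fun f hf hf1 => ?_
    obtain ⟨p, hp⟩ := hforce1 f (hQW hf) hf1
    obtain ⟨hpX, -, hadj⟩ := hp.adj_of_compl (connectedOn_compl_of_adj hQ hv)
      (fun c hc => hWX' c (hQW hc)) hf
    have hS : Special v p (Q.erase f) := by
      refine special_of_common_neighbors ?_ ?_ fun c hc => ?_
      · rintro rfl
        exact hWX' v (hPW (Finset.mem_singleton_self v)) hpX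
      · rw [Finset.card_erase_of_mem hf, hQ]
      · obtain ⟨hcf, hc⟩ := Finset.mem_erase.1 hc
        exact ⟨hv c hc, hadj c hc hcf⟩
    have hlate : ∀ c ∈ Q.erase f, c ∉ (graphH k)ᶜ.psdBlue X 1 := by
      intro c hc hc1
      obtain ⟨hcf, hc⟩ := Finset.mem_erase.1 hc
      obtain ⟨q, hq⟩ := hforce1 c (hQW hc) hc1
      exact hcf (eq_of_force_of_force hQ hv (fun c hc => hWX' c (hQW hc)) hc hf hq hp)
    obtain ⟨c, hc, hno⟩ := hS.exists_not_force hlate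
    obtain ⟨q, hq⟩ := hforce2 c (hlate c hc)
    exact hno q hq
  have htwothree : ∀ P Q : Finset (HVertex k), P.card = 2 → Q.card = 3 → Q ⊆ W →
      (∀ p ∈ P, ∀ q ∈ Q, (graphH k).Adj p q) → False := by
    intro P Q hP hQ hQW hPQ
    obtain ⟨p, q, hpq, rfl⟩ := Finset.card_eq_two.1 hP
    have hS : Special p q Q := special_of_common_neighbors hpq hQ.ge fun c hc =>
      ⟨hPQ p (by simp) c hc, hPQ q (by simp) c hc⟩
    obtain ⟨c, -, hc⟩ := hS.exists_late fun c hc => hWX' c (hQW hc)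
    exact hc (by rw [h2]; trivial)
  have hP' := hP.card_pos
  have hQ' := hQ.card_pos
  obtain h | h | h | h : P.card = 1 ∨ P.card = 2 ∨ P.card = 3 ∨ P.card = 4 := by omega
  · exact hone P Q h (by omega) hPW hQW hPQ
  · exact htwothree P Q h (by omega) hQW hPQ
  · exact htwothree Q P (by omega) h hPW fun a ha b hb => (hPQ b hb a ha).symm
  · exact hone Q P (by omega) h hQW hPW fun a ha b hb => (hPQ b hb a ha).symm

/-! ### The order of `graphH k`, the forcing number of its complement, and the exact sum. -/

theorem card_hVertex (k : ℕ) : Fintype.card (HVertex k) = 2 * k + 8 := by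
  have e : HVertex k ≃ Fin 6 ⊕ Fin (k + 1) ⊕ Fin (k + 1) :=
    { toFun := fun
        | x => Sum.inl 0
        | y => Sum.inl 1
        | x' => Sum.inl 2
        | y' => Sum.inl 3
        | z => Sum.inl 4
        | z' => Sum.inl 5
        | a i => Sum.inr (Sum.inl i)
        | b i => Sum.inr (Sum.inr i)
      invFun := fun
        | Sum.inl 0 => x
        | Sum.inl 1 => y
        | Sum.inl 2 => x'
        | Sum.inl 3 => y'
        | Sum.inl 4 => z
        | Sum.inl 5 => z'
        | Sum.inr (Sum.inl i) => a i
        | Sum.inr (Sum.inr i) => b i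
      left_inv := fun v => by cases v <;> rfl
      right_inv := fun v => by
        rcases v with i | i | i
        · fin_cases i <;> rfl
        · rfl
        · rfl }
  rw [Fintype.card_congr e]
  simp
  omega

theorem psdForcingNumber_compl_graphH_le (k : ℕ) :
    (graphH k)ᶜ.psdForcingNumber ≤ 2 * k + 3 := by
  -- In the complement these five are forced in the order `y → a 0`, `z' → x`, `x → x'`, `a 0 → z`,
  -- `z → y'`.
  set W : Finset (HVertex k) := {x, x', y', z, a 0} with hW
  have hcard : W.card = 5 := by simp [hW]
  have hforce : (graphH k)ᶜ.IsPSDForcingSet Wᶜ := by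
    refine SimpleGraph.isPSDForcingSet_of_closed fun K hK hclosed => ?_
    have hK' : ∀ v, v = x ∨ v = x' ∨ v = y' ∨ v = z ∨ v = a 0 ∨ v ∈ K := fun v => by
      by_cases hv : v ∈ W
      · simp [hW] at hv
        tauto
      · exact Or.inr (Or.inr (Or.inr (Or.inr (Or.inr (hK v (by simpa using hv))))))
    have step : ∀ u ∈ K, ∀ w, ¬ (graphH k).Adj u w → u ≠ w →
        (∀ v, v ∈ K ∨ v = w ∨ (graphH k).Adj u v) → w ∈ K := by
      intro u hu w huw hne h
      refine hclosed u hu w ((SimpleGraph.compl_adj _ _ _).2 ⟨hne, huw⟩) fun v huv hvw => ?_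
      rcases h v with h | h | h
      · exact h
      · exact absurd h hvw
      · exact absurd h ((SimpleGraph.compl_adj _ _ _).1 huv).2
    have hy : y ∈ K := by simpa using hK' y
    have hz' : z' ∈ K := by simpa using hK' z'
    have h1 : a 0 ∈ K := step y hy _ (by simp [adj_y]) (by simp) fun v => by
      rcases hK' v with rfl | rfl | rfl | rfl | rfl | h <;> simp [adj_y, *]
    have h2 : x ∈ K := step z' hz' _ (by simp [adj_z']) (by simp) fun v => by
      rcases hK' v with rfl | rfl | rfl | rfl | rfl | h <;> simp [adj_z', *]
    have h3 : x' ∈ K := step x h2 _ (by simp [adj_x]) (by simp) fun v => by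
      rcases hK' v with rfl | rfl | rfl | rfl | rfl | h <;> simp [adj_x, *]
    have h4 : z ∈ K := step (a 0) h1 _ (by simp [adj_a]) (by simp) fun v => by
      rcases hK' v with rfl | rfl | rfl | rfl | rfl | h <;> simp [adj_a, *]
    have h5 : y' ∈ K := step z h4 _ (by simp [adj_z]) (by simp) fun v => by
      rcases hK' v with rfl | rfl | rfl | rfl | rfl | h <;> simp [*]
    intro v
    rcases hK' v with rfl | rfl | rfl | rfl | rfl | h <;> assumption
  refine hforce.psdForcingNumber_le.trans ?_
  rw [Finset.card_compl, card_hVertex, hcard]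
  omega

theorem three_le_psdPropTime_compl_graphH (k : ℕ) : 3 ≤ (graphH k)ᶜ.psdPropTime := by
  refine mod_cast SimpleGraph.le_psdPropTime (s := 3) fun B t hB ht => ?_
  have hBc : 5 ≤ Bᶜ.card := by
    have := psdForcingNumber_compl_graphH_le k
    rw [Finset.card_compl, card_hVertex]
    omega
  -- By monotonicity, additional blue vertices only help, so exactly five white vertices may be
  -- kept.
  obtain ⟨W, hWB, hW⟩ := Finset.exists_subset_card_eq hBc
  by_contra hlt
  refine psdBlue_two_ne_univ (X := (W : Set (HVertex k))ᶜ) hW (fun v => Iff.rfl)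
    (Set.eq_univ_of_univ_subset ?_)
  rw [← ht]
  refine (SimpleGraph.psdBlue_mono_time (by omega : t ≤ 2)).trans
    (SimpleGraph.psdBlue_mono (fun v hv hvW => ?_) 2)
  exact Finset.mem_compl.1 (hWB hvW) hv

theorem psdPropTime_add_compl_graphH (k : ℕ) :
    (graphH k).psdPropTime + (graphH k)ᶜ.psdPropTime = ((k + 6 : ℕ) : ℕ∞) := by
  refine le_antisymm ?_ ?_
  · obtain ⟨m, hm, hm'⟩ := SimpleGraph.exists_psdPropTime_add_compl_le (graphH k)
    rw [card_hVertex] at hm'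
    exact hm.trans (by exact_mod_cast (by omega : m ≤ k + 6))
  · refine le_trans ?_
      (add_le_add (le_psdPropTime_graphH k) (three_le_psdPropTime_compl_graphH k))
    norm_cast

end HVertex

theorem theoremt :
    (∀ {V : Type*} [Fintype V] (G : SimpleGraph V), 2 ≤ Fintype.card V →
      1 ≤ G.psdPropTime + Gᶜ.psdPropTime ∧
      ((G.psdPropTime + Gᶜ.psdPropTime : ℕ∞) : ℝ≥0∞) ≤ (Fintype.card V : ℝ≥0∞) / 2 + 2) ∧
    (∀ n : ℕ, 2 ≤ n →
      (⊤ : SimpleGraph (Fin n)).psdPropTime + (⊤ : SimpleGraph (Fin n))ᶜ.psdPropTime = 1) ∧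
    (∀ k : ℕ, Fintype.card (HVertex k) = 2 * k + 8 ∧
      (((graphH k).psdPropTime + (graphH k)ᶜ.psdPropTime : ℕ∞) : ℝ≥0∞) =
        ((2 * k + 8 : ℕ) : ℝ≥0∞) / 2 + 2) := by
  refine ⟨fun G hn => ⟨G.one_le_psdPropTime_add_compl hn, ?_⟩, fun n hn => ?_, fun k =>
    ⟨HVertex.card_hVertex k, ?_⟩⟩
  · obtain ⟨m, hm, hm'⟩ := G.exists_psdPropTime_add_compl_le
    exact (ENat.toENNReal_le.2 hm).trans (SimpleGraph.natCast_le_half_add_two hm')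
  · rw [compl_top, SimpleGraph.psdPropTime_bot, SimpleGraph.psdPropTime_top (by simpa using hn),
      add_zero]
  · rw [HVertex.psdPropTime_add_compl_graphH, ENat.toENNReal_coe,
      show ((2 * k + 8 : ℕ) : ℝ≥0∞) / 2 = ((k + 4 : ℕ) : ℝ≥0∞) from
        ((ENNReal.eq_div_iff (by norm_num) (by norm_num)).2 (by push_cast; ring)).symm]
    push_cast
    ring
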